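/- Superoperators are linear maps $\mathbb C^{d_{\mathrm{in}}\times d_{\mathrm{in}}}\to\mathbb C^{d_{\mathrm{out}}\times d_{\mathrm{out}}}$; a channel is a completely positive, trace-preserving superoperator. For a superoperator $\mathcal L$ let $$J(\mathcal L)=\frac1{d_{\mathrm{in}}}\sum_{i,j=1}^{d_{\mathrm{in}}}\mathcal L(|i\rangle\langle j|)\otimes|i\rangle\langle j|,\qquad \|\mathcal L\|_{\mathrm{ACID}}=\|J(\mathcal L)\|_1 ,$$ where $\|\cdot\|_1$ is the trace norm (the sum of the singular values). A deterministic ancilla-free, non-adaptive tester making $n$ queries consists of pure states $\psi_1,\dots,\psi_n$ on $\mathbb C^{d_{\mathrm{in}}}$, POVMs $P^{(1)},\dots,P^{(n)}$ on $\mathbb C^{d_{\mathrm{out}}}$ with finitely many outcomes, and a function $f$ from strings of outcomes to $\{\mathrm{Accept},\mathrm{Reject}\}$; given a channel $\mathcal M$, it measures $P^{(j)}$ on $\mathcal M(\psi_j)$ independently for each $j$ and outputs $f$ of the string of outcomes. A (randomized) ancilla-free, non-adaptive tester making $n$ queries is a random choice of a deterministic one making $n$ queries. **Theorem.** There are universal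 constants $C>0$ and $k\in\mathbb N$ such that the following holds for all integers $d_{\mathrm{in}},d_{\mathrm{out}}\ge1$, every channel $\mathcal N:\mathbb C^{d_{\mathrm{in}}\times d_{\mathrm{in}}}\to\mathbb C^{d_{\mathrm{out}}\times d_{\mathrm{out}}}$ and every $\varepsilon>0$. Put $F=d_{\mathrm{in}}d_{\mathrm{out}}^{3/2}/\varepsilon^2$. Then there is a randomized ancilla-free, non-adaptive tester making $n\le C\,F\,\log_2(2+F)^k$ queries (that is, $\tilde O(d_{\mathrm{in}}d_{\mathrm{out}}^{3/2}/\varepsilon^2)$ queries) to a channel $\mathcal M:\mathbb C^{d_{\mathrm{in}}\times d_{\mathrm{in}}}\to\mathbb C^{d_{\mathrm{out}}\times d_{\mathrm{out}}}$ such that - if $\mathcal M=\mathcal N$, it accepts with probability at least $2/3$; - if $\|\mathcal M-\mathcal N\|_{\mathrm{ACID}}\ge\varepsilon$, it rejects with probability at least $2/3$. -/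

import Mathlib

namespace ChannelTesting

open scoped BigOperators ComplexOrder
open MeasureTheory

/-- A superoperator: a complex-linear map from `din × din` to `dout × dout` complex matrices. -/
abbrev Superop (din dout : ℕ) : Type :=
  Matrix (Fin din) (Fin din) ℂ →ₗ[ℂ] Matrix (Fin dout) (Fin dout) ℂ

/-- `(L ⊗ I_k) X`, where the first index of a pair belongs to the register on which `L` acts and
the second one to the `k`-dimensional ancillary register: the `(p, q)` block `X_{(·,p),(·,q)}` of
`X` is replaced by its image under `L`. -/
def ampliation {din dout : ℕ} (L : Superop din dout) (k : ℕ)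
    (X : Matrix (Fin din × Fin k) (Fin din × Fin k) ℂ) :
    Matrix (Fin dout × Fin k) (Fin dout × Fin k) ℂ :=
  Matrix.of fun a b => L (Matrix.of fun i j => X (i, a.2) (j, b.2)) a.1 b.1

/-- The maximally entangled state `Φ_d = (1/d) ∑_{i,j} |ii⟩⟨jj|`. -/
noncomputable def maxEntangled (d : ℕ) : Matrix (Fin d × Fin d) (Fin d × Fin d) ℂ :=
  Matrix.of fun a b => if a.1 = a.2 ∧ b.1 = b.2 then 1 / (d : ℂ) else 0

/-- The (normalized) Choi operator `J(L) = (L ⊗ I) Φ`. -/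
noncomputable def choi {din dout : ℕ} (L : Superop din dout) :
    Matrix (Fin dout × Fin din) (Fin dout × Fin din) ℂ :=
  ampliation L din (maxEntangled din)

/-- A channel: a completely positive and trace-preserving superoperator. -/
structure IsChannel {din dout : ℕ} (L : Superop din dout) : Prop where
  completelyPositive : ∀ (k : ℕ) (X : Matrix (Fin din × Fin k) (Fin din × Fin k) ℂ),
    X.PosSemidef → (ampliation L k X).PosSemidef
  tracePreserving : ∀ X : Matrix (Fin din) (Fin din) ℂ, (L X).trace = X.trace

/-- The trace norm (Schatten 1-norm): the sum of the singular values. -/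
noncomputable def traceNorm {ι : Type*} [Fintype ι] [DecidableEq ι] (A : Matrix ι ι ℂ) : ℝ :=
  (Matrix.toEuclideanLin A).singularValues.sum fun _ s => s

/-- The average-case imitation diamond norm: the trace norm of the Choi operator. -/
noncomputable def acidNorm {din dout : ℕ} (L : Superop din dout) : ℝ :=
  traceNorm (choi L)

/-- A deterministic ancilla-free, non-adaptive channel tester making `n` queries: pure input
states `|ψ_j⟩`, POVMs `P^(j)` on the output space with `m_j` outcomes each, and a decision function
of the string of outcomes (`true` is accept, `false` is reject). -/
structure DetTester (din dout n : ℕ) where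
  ket : Fin n → EuclideanSpace ℂ (Fin din)
  norm_ket : ∀ j, ‖ket j‖ = 1
  m : Fin n → ℕ
  povm : (j : Fin n) → Fin (m j) → Matrix (Fin dout) (Fin dout) ℂ
  povm_posSemidef : ∀ j a, (povm j a).PosSemidef
  povm_sum : ∀ j, ∑ a, povm j a = 1
  decision : ((j : Fin n) → Fin (m j)) → Bool

namespace DetTester

variable {din dout n : ℕ}

/-- The density matrix `|ψ_j⟩⟨ψ_j|` of the `j`-th input state. -/
def state (T : DetTester din dout n) (j : Fin n) : Matrix (Fin din) (Fin din) ℂ :=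
  Matrix.vecMulVec (T.ket j).ofLp (star (T.ket j).ofLp)

/-- The probability that performing `P^(j)` on `M(ψ_j)`, for every `j`, yields the string `x`. -/
noncomputable def outcomeProb (T : DetTester din dout n) (M : Superop din dout)
    (x : (j : Fin n) → Fin (T.m j)) : ℝ :=
  ∏ j, ((T.povm j (x j) * M (T.state j)).trace).re

/-- The probability that the tester outputs `b` when it queries `M`. -/
noncomputable def outputProb (T : DetTester din dout n) (M : Superop din dout) (b : Bool) : ℝ :=
  ∑ x : (j : Fin n) → Fin (T.m j), if T.decision x = b then T.outcomeProb M x else 0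

end DetTester

/-- A randomized ancilla-free, non-adaptive channel tester making `n` queries: a deterministic
tester chosen at random (before any query is made) according to a probability measure. -/
structure RandTester (din dout n : ℕ) where
  Ω : Type
  [measurableSpace : MeasurableSpace Ω]
  μ : Measure Ω
  isProbabilityMeasure : IsProbabilityMeasure μ
  tester : Ω → DetTester din dout n
  measurable_outputProb : ∀ M : Superop din dout, IsChannel M → ∀ b : Bool,
    Measurable fun ω => (tester ω).outputProb M b

/-- The probability that a randomized tester outputs `b` when it queries `M`, over the choice of
the deterministic tester and over the outcomes of the measurements. -/
noncomputable def RandTester.outputProb {din dout n : ℕ} (T : RandTester din dout n)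
    (M : Superop din dout) (b : Bool) : ℝ :=
  letI := T.measurableSpace
  ∫ ω, (T.tester ω).outputProb M b ∂T.μ

/-- The tester decides, with success probability at least `2/3`, whether the queried channel is
`N` (then it has to accept) or at ACID distance at least `ε` from `N` (then it has to reject). -/
def RandTester.Decides {din dout n : ℕ} (T : RandTester din dout n) (N : Superop din dout)
    (ε : ℝ) : Prop :=
  ∀ M : Superop din dout, IsChannel M →
    (M = N → 2 / 3 ≤ T.outputProb M true) ∧
    (ε ≤ acidNorm (M - N) → 2 / 3 ≤ T.outputProb M false)

end ChannelTesting

/-!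
The tester compares outcome statistics for random inputs and random measurements, and no
logarithmic factor is needed.

Put `L = M - N`. The trace norm of the Choi operator is at most `√(din · dout)` times its Frobenius
norm, so `acidNorm L ^ 2 ≤ (dout / din) · ∑ ‖L(E_xy)_ab‖²`. For a suitable random vector `v`
(`signVec`), built from independent signs, the second moment of `v† B v` dominates the squared
Frobenius norm of `B`. Applied on the input and on the output side, this bounds
`∑ ‖L(E_xy)_ab‖²` by the second moment of `u† L(v v†) u` over independent random vectors `u`, `v`
(`le_expect_signForm`).

A measurement whose outcomes are all distributed like such a `u` is obtained by multiplying the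
signs of `u` by the rows of a `K × 3·dout` sign matrix with orthogonal columns and
`K ≤ 6·dout`. For a fixed pair of sign strings, let `p` and `q` be the outcome distributions of `M`
and `N`. On average over the sign strings,

* `‖p - q‖₂²`, scaled by `‖v‖⁴`, has mean `μ ≳ ε² din / (K dout)` whenever `M` is `ε`-far from `N`;
* its second moment is `O(μ²)`, because `u† L(v v†) u` has degree four in the signs and is therefore
  hypercontractive (`LowDeg.expect_pow_four_le`);
* `‖p‖₂² ≤ 3 / K` for every channel: the random signs flatten the outcome distribution.

From two independent batches of `m` samples, the inner product of the two empirical deviations from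
`q` is an unbiased estimator of `‖p - q‖₂²`, with second moment at most
`2 ‖p - q‖₂⁴ + 3 ‖p‖₂² / m²` (`expect_pairStat_sq_le`). With
`m ≍ din · dout^(3/2) / ε²` the noise term is below the square of the signal that has to be
detected, so Chebyshev's inequality for a constant number of independent repetitions separates the
two cases. If `din · dout^(3/2) / ε²` is smaller than a constant, no channel is `ε`-far from `N`, and
accepting without any query is correct.
-/

namespace ChannelTesting

open scoped BigOperators ComplexOrder
open MeasureTheory

/-! ### Trace norm and Frobenius norm -/

/-- Cauchy–Schwarz for the singular values, whose squares sum to the squared Frobenius norm. -/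
theorem traceNorm_sq_le {ι : Type*} [Fintype ι] [DecidableEq ι] (A : Matrix ι ι ℂ) :
    traceNorm A ^ 2 ≤ Fintype.card ι * ∑ i, ∑ j, ‖A i j‖ ^ 2 := by
  set T := Matrix.toEuclideanLin A with hT
  set n := Fintype.card ι
  have hn : Module.finrank ℂ (EuclideanSpace ℂ ι) = n := by simp [n]
  have hsum : traceNorm A = ∑ i : Fin n, T.singularValues i := by
    rw [traceNorm, Finsupp.sum_of_support_subset (s := Finset.range n), Finset.sum_range]
    · intro i hi
      by_contra hlt
      rw [Finsupp.mem_support_iff] at hi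
      exact hi (T.singularValues_of_finrank_le (by simpa [hn] using hlt))
    · simp
  have hsq : ∑ i : Fin n, T.singularValues i ^ 2 = ∑ i, ∑ j, ‖A i j‖ ^ 2 := by
    simp_rw [T.sq_singularValues_fin hn]
    rw [← T.isSymmetric_adjoint_comp_self.re_trace_eq_sum_eigenvalues hn,
      LinearMap.trace_eq_sum_inner _ (EuclideanSpace.basisFun ι ℂ), Finset.sum_comm, map_sum]
    refine Finset.sum_congr rfl fun i _ => ?_
    rw [LinearMap.comp_apply, LinearMap.adjoint_inner_right, inner_self_eq_norm_sq_to_K,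
      ← RCLike.ofReal_pow, RCLike.ofReal_re, EuclideanSpace.norm_sq_eq]
    refine Finset.sum_congr rfl fun j _ => ?_
    simp [hT, Matrix.toLpLin_apply]
  rw [hsum, ← hsq]
  simpa using sq_sum_le_card_mul_sum_sq (s := Finset.univ) (f := fun i : Fin n => T.singularValues i)

/-! ### Second moments of quadratic forms in random signs -/

section signs

variable {ι : Type*} [Fintype ι] [DecidableEq ι]

theorem expect_eq_zero_of_flip {R : Type*} [Field R] [CharZero R] (i : ι)
    (F : (ι → ℤˣ) → R) (hF : ∀ s, F (Function.update s i (-s i)) = -F s) :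
    𝔼 s, F s = 0 := by
  have hinv : Function.Involutive fun s : ι → ℤˣ => Function.update s i (-s i) := by
    intro s
    simp
  have h := Fintype.expect_equiv hinv.toPerm (fun s => F (Function.update s i (-s i))) F
    fun s => rfl
  simp_rw [hF] at h
  rw [Finset.expect_neg_distrib] at h
  exact self_eq_neg.mp h.symm

theorem expect_sign_mul_sign {R : Type*} [Field R] [CharZero R] (a b : ι) :
    𝔼 s : ι → ℤˣ, ((s a : ℤ) : R) * ((s b : ℤ) : R) = if a = b then 1 else 0 := by
  split_ifs with h
  · subst h
    have : ∀ s : ι → ℤˣ, ((s a : ℤ) : R) * ((s a : ℤ) : R) = 1 := fun s => by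
      rw [← Int.cast_mul, Int.units_coe_mul_self]; simp
    simp [this]
  · exact expect_eq_zero_of_flip a _ fun s => by simp [Function.update_of_ne (Ne.symm h)]

theorem expect_four_signs {R : Type*} [Field R] [CharZero R] (a b c d : ι) :
    𝔼 s : ι → ℤˣ, ((s a : ℤ) : R) * ((s b : ℤ) : R) * (((s c : ℤ) : R) * ((s d : ℤ) : R)) =
      (if a = b ∧ c = d then 1 else 0) + (if a = c ∧ b = d then 1 else 0)
        + (if a = d ∧ b = c then 1 else 0) - 2 * (if a = b ∧ b = c ∧ c = d then 1 else 0) := by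
  have hsq : ∀ (s : ι → ℤˣ) (i : ι), ((s i : ℤ) : R) * ((s i : ℤ) : R) = 1 := fun s i => by
    rw [← Int.cast_mul, Int.units_coe_mul_self]; simp
  by_cases hab : a = b
  · subst hab
    simp_rw [hsq, one_mul, expect_sign_mul_sign]
    split_ifs <;> first | (exfalso; grind) | norm_num
  by_cases hac : a = c
  · subst hac
    have : ∀ s : ι → ℤˣ, ((s a : ℤ) : R) * ((s b : ℤ) : R) * (((s a : ℤ) : R) * ((s d : ℤ) : R)) =
        ((s b : ℤ) : R) * ((s d : ℤ) : R) := fun s => by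
      linear_combination ((s b : ℤ) : R) * ((s d : ℤ) : R) * hsq s a
    simp_rw [this, expect_sign_mul_sign]
    have hba : ¬ b = a := fun h => hab h.symm
    simp [hab, hba]
  by_cases had : a = d
  · subst had
    have : ∀ s : ι → ℤˣ, ((s a : ℤ) : R) * ((s b : ℤ) : R) * (((s c : ℤ) : R) * ((s a : ℤ) : R)) =
        ((s b : ℤ) : R) * ((s c : ℤ) : R) := fun s => by
      linear_combination ((s b : ℤ) : R) * ((s c : ℤ) : R) * hsq s a
    simp_rw [this, expect_sign_mul_sign]
    simp [hab, hac]
  · simp only [hab, hac, had, false_and, if_false]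
    rw [expect_eq_zero_of_flip a]
    · simp
    · intro s
      simp [Function.update_of_ne (Ne.symm hab), Function.update_of_ne (Ne.symm hac),
        Function.update_of_ne (Ne.symm had)]

/-- The second moment of a quadratic form in independent signs: only the trace and the symmetrized
off-diagonal coefficients matter, since `s a * s b = s b * s a` and `s a ^ 2 = 1`. -/
theorem expect_normSq_quadForm (C : ι → ι → ℂ) :
    𝔼 s : ι → ℤˣ, ‖∑ a, ∑ b, C a b * ((s a : ℤ) : ℂ) * ((s b : ℤ) : ℂ)‖ ^ 2 =
      ‖∑ a, C a a‖ ^ 2 + 1 / 2 * ∑ a, ∑ b, (if a = b then 0 else ‖C a b + C b a‖ ^ 2) := by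
  have key : 𝔼 s : ι → ℤˣ, (∑ a, ∑ b, C a b * ((s a : ℤ) : ℂ) * ((s b : ℤ) : ℂ)) *
      (∑ c, ∑ d, star (C c d) * ((s c : ℤ) : ℂ) * ((s d : ℤ) : ℂ)) =
      (∑ a, C a a) * (∑ c, star (C c c)) + ∑ a, ∑ b, C a b * star (C a b)
       + ∑ a, ∑ b, C a b * star (C b a) - 2 * ∑ a, C a a * star (C a a) := by
    have h1 : ∀ s : ι → ℤˣ, (∑ a, ∑ b, C a b * ((s a : ℤ) : ℂ) * ((s b : ℤ) : ℂ)) *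
      (∑ c, ∑ d, star (C c d) * ((s c : ℤ) : ℂ) * ((s d : ℤ) : ℂ)) =
      ∑ a, ∑ b, ∑ c, ∑ d, C a b * star (C c d) * (((s a : ℤ) : ℂ) * ((s b : ℤ) : ℂ) *
        (((s c : ℤ) : ℂ) * ((s d : ℤ) : ℂ))) := fun s => by
      simp_rw [Finset.sum_mul, Finset.mul_sum]
      refine Finset.sum_congr rfl fun a _ => Finset.sum_congr rfl fun b _ =>
        Finset.sum_congr rfl fun c _ => Finset.sum_congr rfl fun d _ => by ring
    simp_rw [h1, Finset.expect_sum_comm, ← Finset.mul_expect, expect_four_signs, mul_sub, mul_add,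
      Finset.sum_sub_distrib, Finset.sum_add_distrib]
    congr 1
    · congr 1
      · congr 1
        · simp [ite_and, Finset.sum_mul, Finset.mul_sum]
          exact Finset.sum_comm
        · simp [ite_and]
      · simp [ite_and]
    · simp [ite_and, Finset.mul_sum, mul_left_comm, mul_comm]
  have hre : ∀ s : ι → ℤˣ, ((‖∑ a, ∑ b, C a b * ((s a : ℤ) : ℂ) * ((s b : ℤ) : ℂ)‖ ^ 2 : ℝ) : ℂ) =
      (∑ a, ∑ b, C a b * ((s a : ℤ) : ℂ) * ((s b : ℤ) : ℂ)) *
      (∑ c, ∑ d, star (C c d) * ((s c : ℤ) : ℂ) * ((s d : ℤ) : ℂ)) := fun s => by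
    rw [Complex.ofReal_pow, ← Complex.mul_conj']
    simp
  have hexp : ∀ F : (ι → ℤˣ) → ℝ, ((𝔼 s, F s : ℝ) : ℂ) = 𝔼 s, (F s : ℂ) := fun F =>
    Complex.ofReal_expect _ F
  apply Complex.ofReal_injective
  rw [hexp]
  simp_rw [hre]
  rw [key]
  have hoff : ∀ a b, (if a = b then 0 else ‖C a b + C b a‖ ^ 2) =
      ‖C a b + C b a‖ ^ 2 - (if a = b then 4 * ‖C a a‖ ^ 2 else 0) := fun a b => by
    split_ifs with h
    · subst h
      rw [← two_mul, norm_mul]; norm_num; ring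
    · simp
  simp_rw [hoff, Finset.sum_sub_distrib]
  push_cast
  simp_rw [← Complex.mul_conj']
  simp only [Finset.sum_ite_eq, Finset.mem_univ, if_true, map_add, map_sum, add_mul, mul_add,
    Finset.sum_add_distrib, apply_ite Complex.ofReal, Complex.ofReal_zero]
  rw [Finset.sum_comm (f := fun x y => C y x * (starRingEnd ℂ) (C y x)),
    Finset.sum_comm (f := fun x y => C y x * (starRingEnd ℂ) (C x y))]
  push_cast
  simp_rw [← Complex.mul_conj', Complex.star_def, ← Finset.mul_sum]
  ring

end signs

/-! ### Low-degree polynomials in random signs are hypercontractive -/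

/-- `LowDeg n d f` says that `f` is a polynomial of degree at most `d` in `n` signs. The recursion
splits off the first sign `a`, writing `f = g + a * h` with `h` of degree at most `d - 1`; the
clause `d = 0 → h = 0` makes up for the truncated subtraction. -/
def LowDeg {R : Type*} [CommRing R] : (n d : ℕ) → ((Fin n → ℤˣ) → R) → Prop
  | 0, _, _ => True
  | n + 1, d, f => ∃ g h : (Fin n → ℤˣ) → R, LowDeg n d g ∧ LowDeg n (d - 1) h ∧
      (d = 0 → h = 0) ∧ ∀ (a : ℤˣ) (s : Fin n → ℤˣ),
        f (Fin.cons a s) = g s + ((a : ℤ) : R) * h s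

namespace LowDeg

variable {R : Type*} [CommRing R]

theorem const (c : R) : ∀ n d : ℕ, LowDeg n d fun _ => c
  | 0, _ => trivial
  | n + 1, d => ⟨fun _ => c, fun _ => 0, const c n d, const 0 n (d - 1), fun _ => rfl, by simp⟩

theorem add : ∀ {n d : ℕ} {f₁ f₂ : (Fin n → ℤˣ) → R}, LowDeg n d f₁ → LowDeg n d f₂ →
    LowDeg n d fun s => f₁ s + f₂ s
  | 0, _, _, _, _, _ => trivial
  | _ + 1, _, _, _, ⟨g₁, h₁, hg₁, hh₁, hz₁, e₁⟩, ⟨g₂, h₂, hg₂, hh₂, hz₂, e₂⟩ =>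
    ⟨fun s => g₁ s + g₂ s, fun s => h₁ s + h₂ s, hg₁.add hg₂, hh₁.add hh₂,
      fun hd => by simp [hz₁ hd, hz₂ hd]; rfl, fun a s => by simp only [e₁, e₂]; ring⟩

theorem const_mul (c : R) : ∀ {n d : ℕ} {f : (Fin n → ℤˣ) → R}, LowDeg n d f →
    LowDeg n d fun s => c * f s
  | 0, _, _, _ => trivial
  | _ + 1, _, _, ⟨g, h, hg, hh, hz, e⟩ =>
    ⟨fun s => c * g s, fun s => c * h s, hg.const_mul c, hh.const_mul c,
      fun hd => by simp [hz hd]; rfl, fun a s => by simp only [e]; ring⟩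

theorem sum {n d : ℕ} {κ : Type*} (t : Finset κ) {f : κ → (Fin n → ℤˣ) → R}
    (hf : ∀ i ∈ t, LowDeg n d (f i)) : LowDeg n d fun s => ∑ i ∈ t, f i s := by
  classical
  induction t using Finset.induction_on with
  | empty => simpa using const 0 n d
  | insert i t hi ih =>
    simp_rw [Finset.sum_insert hi]
    exact (hf i (Finset.mem_insert_self i t)).add
      (ih fun j hj => hf j (Finset.mem_insert_of_mem hj))

theorem mono : ∀ {n d e : ℕ} {f : (Fin n → ℤˣ) → R}, d ≤ e → LowDeg n d f → LowDeg n e f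
  | 0, _, _, _, _, _ => trivial
  | _ + 1, _, _, _, hde, ⟨g, h, hg, hh, hz, eq⟩ =>
    ⟨g, h, hg.mono hde, hh.mono (Nat.sub_le_sub_right hde 1),
      fun he => hz (by omega), eq⟩

theorem sign_mul : ∀ {n d : ℕ} {f : (Fin n → ℤˣ) → R} (i : Fin n), LowDeg n d f →
    LowDeg n (d + 1) fun s => ((s i : ℤ) : R) * f s
  | 0, _, _, i, _ => i.elim0
  | n + 1, d, f, i, ⟨g, h, hg, hh, hz, eq⟩ => by
    refine Fin.cases ?_ (fun j => ?_) i
    · refine ⟨h, g, hh.mono (by omega), hg, by simp, fun a s => ?_⟩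
      have ha : ((a : ℤ) : R) * ((a : ℤ) : R) = 1 := by
        rw [← Int.cast_mul, Int.units_coe_mul_self, Int.cast_one]
      simp only [eq, Fin.cons_zero]
      linear_combination h s * ha
    · refine ⟨_, fun s => ((s j : ℤ) : R) * h s, hg.sign_mul j, ?_, by simp, fun a s => ?_⟩
      · rcases Nat.eq_zero_or_pos d with hd | hd
        · simpa [hz hd] using const 0 n _
        · have := hh.sign_mul j
          rwa [Nat.sub_add_cancel hd] at this
      · simp only [eq, Fin.cons_succ]
        ring

theorem re : ∀ {n d : ℕ} {f : (Fin n → ℤˣ) → ℂ}, LowDeg n d f → LowDeg n d fun s => (f s).re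
  | 0, _, _, _ => trivial
  | _ + 1, _, _, ⟨g, h, hg, hh, hz, e⟩ =>
    ⟨fun s => (g s).re, fun s => (h s).re, hg.re, hh.re,
      fun hd => by simp [hz hd]; rfl, fun a s => by simp [e]⟩

end LowDeg

theorem expect_fin_succ_signs {n : ℕ} (F : (Fin (n + 1) → ℤˣ) → ℝ) :
    𝔼 s, F s = 𝔼 s : Fin n → ℤˣ, (F (Fin.cons 1 s) + F (Fin.cons (-1) s)) / 2 := by
  rw [← Fintype.expect_equiv (Fin.consEquiv fun _ => ℤˣ)
      (fun p => F (Fin.cons p.1 p.2)) F fun _ => rfl, ← Finset.univ_product_univ,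
      Finset.expect_product, Finset.expect_comm]
  refine Finset.expect_congr rfl fun s _ => ?_
  rw [Fintype.expect_eq_sum_div_card]
  simp [UnitsInt.univ]

/-- Bonami's lemma: a polynomial of degree `d` in independent signs has fourth moment at most `9 ^ d`
times its squared second moment. -/
theorem LowDeg.expect_pow_four_le : ∀ {n d : ℕ} {f : (Fin n → ℤˣ) → ℝ}, LowDeg n d f →
    𝔼 s, f s ^ 4 ≤ 9 ^ d * (𝔼 s, f s ^ 2) ^ 2
  | 0, d, f, _ => by
    have : (1 : ℝ) ≤ 9 ^ d := one_le_pow₀ (by norm_num)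
    simp
    nlinarith [sq_nonneg (f default ^ 2)]
  | n + 1, d, f, ⟨g, h, hg, hh, hz, eq⟩ => by
    have e4 : 𝔼 s, f s ^ 4 = 𝔼 s, g s ^ 4 + 6 * 𝔼 s, g s ^ 2 * h s ^ 2 + 𝔼 s, h s ^ 4 := by
      rw [expect_fin_succ_signs, Finset.mul_expect, ← Finset.expect_add_distrib,
        ← Finset.expect_add_distrib]
      refine Finset.expect_congr rfl fun s _ => ?_
      simp only [eq]
      push_cast
      ring
    have e2 : 𝔼 s, f s ^ 2 = 𝔼 s, g s ^ 2 + 𝔼 s, h s ^ 2 := by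
      rw [expect_fin_succ_signs, ← Finset.expect_add_distrib]
      refine Finset.expect_congr rfl fun s _ => ?_
      simp only [eq]
      push_cast
      ring
    have ihg := hg.expect_pow_four_le
    have ihh := hh.expect_pow_four_le
    have cs := Finset.expect_mul_sq_le_sq_mul_sq Finset.univ (fun s => g s ^ 2) (fun s => h s ^ 2)
    simp only [← pow_mul] at cs
    norm_num at cs
    have ha : 0 ≤ 𝔼 s, g s ^ 2 := Finset.expect_nonneg fun s _ => sq_nonneg _
    have hb : 0 ≤ 𝔼 s, h s ^ 2 := Finset.expect_nonneg fun s _ => sq_nonneg _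
    have hc : 0 ≤ 𝔼 s, h s ^ 4 := Finset.expect_nonneg fun s _ => by positivity
    rw [e4, e2]
    rcases Nat.eq_zero_or_pos d with hd | hd
    · subst hd
      simpa [hz rfl] using ihg
    generalize 𝔼 s, g s ^ 2 = a at *
    generalize 𝔼 s, h s ^ 2 = b at *
    generalize 𝔼 s, g s ^ 2 * h s ^ 2 = x at *
    obtain ⟨e, rfl⟩ : ∃ e, d = e + 1 := ⟨d - 1, by omega⟩
    simp only [Nat.add_sub_cancel] at ihh
    have hp : (0 : ℝ) ≤ 9 ^ e := by positivity
    have hx : x ≤ 3 * 9 ^ e * (a * b) := by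
      refine abs_le_of_sq_le_sq' (cs.trans ?_) (by positivity) |>.2
      calc _ ≤ (9 ^ (e + 1) * a ^ 2) * (9 ^ e * b ^ 2) := by gcongr
        _ = _ := by ring
    have : 9 ^ e * b ^ 2 ≤ 9 ^ (e + 1) * b ^ 2 := by
      gcongr <;> norm_num
    calc _ ≤ 9 ^ (e + 1) * a ^ 2 + 6 * (3 * 9 ^ e * (a * b)) + 9 ^ (e + 1) * b ^ 2 := by
          gcongr
          exact ihh.trans this
      _ = _ := by ring

/-! ### A random vector with three signs per coordinate -/

section signVec

variable {n : ℕ}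

/-- The coefficients with which the three signs enter each coordinate of `signVec`. Two distinct real
coefficients and an imaginary one make the real, the imaginary and the diagonal parts of a matrix
all visible in the off-diagonal coefficients of the quadratic form in the signs. -/
noncomputable def signCoeff : Fin 3 → ℂ := ![2, 1, Complex.I]

/-- The vector in `ℂⁿ` with coordinates `2 s(x,0) + s(x,1) + i s(x,2)`, which is random when the signs
`s` are. -/
noncomputable def signVec (s : Fin n × Fin 3 → ℤˣ) (x : Fin n) : ℂ :=
  ∑ c, signCoeff c * ((s (x, c) : ℤ) : ℂ)

theorem signVec_quadForm (B : Fin n → Fin n → ℂ) (s : Fin n × Fin 3 → ℤˣ) :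
    ∑ x, ∑ y, star (signVec s x) * B x y * signVec s y =
      ∑ a, ∑ b, star (signCoeff a.2) * signCoeff b.2 * B a.1 b.1 * ((s a : ℤ) : ℂ) *
        ((s b : ℤ) : ℂ) := by
  simp_rw [Fintype.sum_prod_type, signVec, star_sum, Finset.sum_mul, Finset.mul_sum]
  refine Finset.sum_congr rfl fun x _ => ?_
  rw [Finset.sum_comm]
  refine Finset.sum_congr rfl fun c _ => Finset.sum_congr rfl fun y _ =>
    Finset.sum_congr rfl fun c' _ => ?_
  simp only [star_mul', Complex.star_def, map_intCast]
  ring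

theorem sum_star_signCoeff_mul_self : ∑ c, star (signCoeff c) * signCoeff c = 6 := by
  simp [Fin.sum_univ_three, signCoeff, map_ofNat]; norm_num

theorem sum_norm_signCoeff_sq : ∑ c, ‖signCoeff c‖ ^ 2 = 6 := by
  simp [Fin.sum_univ_three, signCoeff]; norm_num

/-- The second moment of `v† B v` dominates the squared Frobenius norm of an arbitrary `B`. -/
theorem le_expect_signVec_quadForm (B : Fin n → Fin n → ℂ) :
    8 * ∑ x, ∑ y, ‖B x y‖ ^ 2 ≤
      𝔼 s, ‖∑ x, ∑ y, star (signVec s x) * B x y * signVec s y‖ ^ 2 := by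
  simp_rw [signVec_quadForm]
  rw [expect_normSq_quadForm (fun a b : Fin n × Fin 3 => star (signCoeff a.2) * signCoeff b.2 * B a.1 b.1)]
  refine le_add_of_nonneg_of_le (sq_nonneg _) ?_
  have hterm : ∀ x y : Fin n, 8 * (‖B x y‖ ^ 2 + ‖B y x‖ ^ 2) ≤
      ∑ c, ∑ c', (if (x, c) = (y, c') then 0 else
        ‖star (signCoeff c) * signCoeff c' * B x y +
          star (signCoeff c') * signCoeff c * B y x‖ ^ 2) := by
    intro x y
    by_cases hxy : x = y
    · subst hxy
      have h01 : (star (signCoeff 0) * signCoeff 1 * B x x +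
          star (signCoeff 1) * signCoeff 0 * B x x) = 4 * B x x := by
        simp [signCoeff]; ring
      simp only [Fin.sum_univ_three, Prod.mk.injEq, true_and, Fin.reduceEq, if_true, if_false, h01,
        norm_mul]
      norm_num
      -- The terms that do not enter the bound are only needed to be nonnegative.
      have : ∀ r₁ r₂ r₃ r₄ r₅ : ℝ, 0 ≤ r₁ → 0 ≤ r₂ → 0 ≤ r₃ → 0 ≤ r₄ → 0 ≤ r₅ →
        8 * (‖B x x‖ ^ 2 + ‖B x x‖ ^ 2) ≤ (4 * ‖B x x‖) ^ 2 + r₁ + (r₂ + r₃) + (r₄ + r₅) := by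
        intros
        nlinarith [sq_nonneg ‖B x x‖]
      apply this <;> positivity
    · have h00 : ‖star (signCoeff 0) * signCoeff 0 * B x y +
          star (signCoeff 0) * signCoeff 0 * B y x‖ ^ 2 = 16 * ‖B x y + B y x‖ ^ 2 := by
        rw [← mul_add, norm_mul, mul_pow]
        simp [signCoeff]; norm_num
      have h02 : ‖star (signCoeff 0) * signCoeff 2 * B x y +
          star (signCoeff 2) * signCoeff 0 * B y x‖ ^ 2 = 4 * ‖B x y - B y x‖ ^ 2 := by
        have : star (signCoeff 0) * signCoeff 2 * B x y + star (signCoeff 2) * signCoeff 0 * B y x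
            = 2 * Complex.I * (B x y - B y x) := by simp [signCoeff]; ring
        rw [this, norm_mul, mul_pow]
        simp; norm_num
      simp only [Fin.sum_univ_three, Prod.mk.injEq, hxy, false_and, if_false, h00, h02]
      have hpar := parallelogram_law_with_norm ℝ (B x y) (B y x)
      have : ∀ r₁ r₂ r₃ r₄ r₅ r₆ r₇ : ℝ, 0 ≤ r₁ → 0 ≤ r₂ → 0 ≤ r₃ → 0 ≤ r₄ → 0 ≤ r₅ → 0 ≤ r₆ →
        0 ≤ r₇ →
        8 * (‖B x y‖ ^ 2 + ‖B y x‖ ^ 2) ≤ 16 * ‖B x y + B y x‖ ^ 2 + r₁ + 4 * ‖B x y - B y x‖ ^ 2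
          + (r₂ + r₃ + r₄) + (r₅ + r₆ + r₇) := by
        intros
        nlinarith [sq_nonneg ‖B x y + B y x‖]
      apply this <;> positivity
  have hsum : 16 * ∑ x, ∑ y, ‖B x y‖ ^ 2 = ∑ x, ∑ y, 8 * (‖B x y‖ ^ 2 + ‖B y x‖ ^ 2) := by
    simp_rw [← Finset.mul_sum, Finset.sum_add_distrib]
    rw [Finset.sum_comm (f := fun x y => ‖B y x‖ ^ 2)]
    ring
  have hle : 16 * ∑ x, ∑ y, ‖B x y‖ ^ 2 ≤ ∑ a : Fin n × Fin 3, ∑ b : Fin n × Fin 3,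
      (if a = b then 0 else ‖star (signCoeff a.2) * signCoeff b.2 * B a.1 b.1 +
          star (signCoeff b.2) * signCoeff a.2 * B b.1 a.1‖ ^ 2) := by
    rw [hsum]
    simp_rw [Fintype.sum_prod_type]
    refine Finset.sum_le_sum fun x _ => ?_
    rw [Finset.sum_comm]
    exact Finset.sum_le_sum fun y _ => hterm x y
  linarith

theorem expect_signVec_quadForm_le (B : Fin n → Fin n → ℂ) :
    𝔼 s, ‖∑ x, ∑ y, star (signVec s x) * B x y * signVec s y‖ ^ 2 ≤
      36 * ‖∑ x, B x x‖ ^ 2 + 72 * ∑ x, ∑ y, ‖B x y‖ ^ 2 := by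
  simp_rw [signVec_quadForm]
  rw [expect_normSq_quadForm (fun a b : Fin n × Fin 3 => star (signCoeff a.2) * signCoeff b.2 * B a.1 b.1)]
  have htr : ∑ a : Fin n × Fin 3, star (signCoeff a.2) * signCoeff a.2 * B a.1 a.1 =
      6 * ∑ x, B x x := by
    simp_rw [Fintype.sum_prod_type, ← Finset.sum_mul, sum_star_signCoeff_mul_self, Finset.mul_sum]
  have hsq : ∑ a : Fin n × Fin 3, ∑ b : Fin n × Fin 3,
      ‖star (signCoeff a.2) * signCoeff b.2 * B a.1 b.1‖ ^ 2 = 36 * ∑ x, ∑ y, ‖B x y‖ ^ 2 := by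
    simp_rw [Fintype.sum_prod_type, norm_mul, mul_pow, norm_star, Finset.mul_sum]
    refine Finset.sum_congr rfl fun x _ => ?_
    rw [Finset.sum_comm]
    refine Finset.sum_congr rfl fun y _ => ?_
    simp_rw [← Finset.sum_mul, ← Finset.mul_sum, sum_norm_signCoeff_sq, ← Finset.sum_mul,
      sum_norm_signCoeff_sq]
    norm_num
  have hle : ∑ a : Fin n × Fin 3, ∑ b : Fin n × Fin 3,
      (if a = b then 0 else ‖star (signCoeff a.2) * signCoeff b.2 * B a.1 b.1 +
          star (signCoeff b.2) * signCoeff a.2 * B b.1 a.1‖ ^ 2) ≤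
      ∑ a : Fin n × Fin 3, ∑ b : Fin n × Fin 3,
        (2 * ‖star (signCoeff a.2) * signCoeff b.2 * B a.1 b.1‖ ^ 2 +
        2 * ‖star (signCoeff b.2) * signCoeff a.2 * B b.1 a.1‖ ^ 2) := by
    refine Finset.sum_le_sum fun a _ => Finset.sum_le_sum fun b _ => ?_
    split_ifs
    · positivity
    · refine (pow_le_pow_left₀ (norm_nonneg _) (norm_add_le _ _) 2).trans ?_
      nlinarith [sq_nonneg (‖star (signCoeff a.2) * signCoeff b.2 * B a.1 b.1‖ -
        ‖star (signCoeff b.2) * signCoeff a.2 * B b.1 a.1‖)]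
  simp_rw [Finset.sum_add_distrib, ← Finset.mul_sum] at hle
  rw [Finset.sum_comm (f := fun a b : Fin n × Fin 3 => ‖star (signCoeff b.2) * signCoeff a.2 * B b.1 a.1‖ ^ 2),
    hsq] at hle
  rw [htr, norm_mul, mul_pow, show ‖(6 : ℂ)‖ = 6 by simp]
  linarith

theorem signVec_eq (s : Fin n × Fin 3 → ℤˣ) (x : Fin n) : signVec s x =
    2 * ((s (x, 0) : ℤ) : ℂ) + ((s (x, 1) : ℤ) : ℂ) + Complex.I * ((s (x, 2) : ℤ) : ℂ) := by
  simp [signVec, signCoeff, Fin.sum_univ_three]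

theorem norm_signVec_sq_bounds (s : Fin n × Fin 3 → ℤˣ) (x : Fin n) :
    2 ≤ ‖signVec s x‖ ^ 2 ∧ ‖signVec s x‖ ^ 2 ≤ 10 := by
  rw [signVec_eq, ← Complex.normSq_eq_norm_sq, Complex.normSq_apply]
  rcases Int.units_eq_one_or (s (x, 0)) with h0 | h0 <;>
    rcases Int.units_eq_one_or (s (x, 1)) with h1 | h1 <;>
    rcases Int.units_eq_one_or (s (x, 2)) with h2 | h2 <;>
    simp [h0, h1, h2] <;> norm_num

end signVec

/-! ### Sums of independent copies, and a collision statistic -/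

section product

variable {ι α : Type*} [Fintype ι] [DecidableEq ι] [Fintype α]

theorem sum_prod_weight_mul (w : α → ℝ) (hw : ∑ x, w x = 1) (f g : α → ℝ) (a b : ι) :
    ∑ y : ι → α, (∏ i, w (y i)) * (f (y a) * g (y b)) =
      if a = b then ∑ x, w x * (f x * g x) else (∑ x, w x * f x) * ∑ x, w x * g x := by
  classical
  have h : ∀ y : ι → α, (∏ i, w (y i)) * (f (y a) * g (y b)) =
      ∏ i, w (y i) * ((if i = a then f (y i) else 1) * (if i = b then g (y i) else 1)) := by
    intro y
    rw [Finset.prod_mul_distrib, Finset.prod_mul_distrib]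
    simp
  simp_rw [h]
  rw [← Fintype.piFinset_univ, ← Finset.prod_univ_sum (fun _ => Finset.univ) (fun i x =>
    w x * ((if i = a then f x else 1) * (if i = b then g x else 1)))]
  split_ifs with hab
  · subst hab
    rw [Finset.prod_eq_single a]
    · simp
    · intro i _ hi
      simp [hi, hw]
    · simp
  · rw [← Finset.mul_prod_erase _ _ (Finset.mem_univ a),
      ← Finset.mul_prod_erase _ _ (Finset.mem_erase.mpr ⟨Ne.symm hab, Finset.mem_univ b⟩),
      Finset.prod_eq_one]
    · simp [hab, Ne.symm hab]
    · intro i hi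
      simp only [Finset.mem_erase] at hi
      simp [hi.1, hi.2.1, hw]

theorem sum_prod_weight (w : α → ℝ) (hw : ∑ x, w x = 1) :
    ∑ y : ι → α, ∏ i, w (y i) = 1 := by
  classical
  rw [← Fintype.piFinset_univ, ← Finset.prod_univ_sum (fun _ => Finset.univ) (fun _ x => w x)]
  simp [hw]

theorem sum_prod_weight_mul_single (w : α → ℝ) (hw : ∑ x, w x = 1) (f : α → ℝ) (a : ι) :
    ∑ y : ι → α, (∏ i, w (y i)) * f (y a) = ∑ x, w x * f x := by
  simpa using sum_prod_weight_mul w hw f (fun _ => 1) a a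

theorem sum_prod_weight_mul_sum (w : α → ℝ) (hw : ∑ x, w x = 1) (f : α → ℝ) :
    ∑ y : ι → α, (∏ i, w (y i)) * ∑ i, f (y i) = Fintype.card ι * ∑ x, w x * f x := by
  simp_rw [Finset.mul_sum (Finset.univ : Finset ι)]
  rw [Finset.sum_comm]
  simp_rw [sum_prod_weight_mul_single w hw]
  rw [Finset.sum_const, Finset.card_univ, nsmul_eq_mul]

theorem sum_prod_weight_mul_sum_mul_sum (w : α → ℝ) (hw : ∑ x, w x = 1) (f g : α → ℝ) :
    ∑ y : ι → α, (∏ i, w (y i)) * ((∑ i, f (y i)) * ∑ i, g (y i)) =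
      Fintype.card ι * (∑ x, w x * (f x * g x)) +
        Fintype.card ι * (Fintype.card ι - 1) * ((∑ x, w x * f x) * ∑ x, w x * g x) := by
  have hexp : ∀ y : ι → α, (∏ i, w (y i)) * ((∑ i, f (y i)) * ∑ i, g (y i)) =
      ∑ a, ∑ b, (∏ i, w (y i)) * (f (y a) * g (y b)) := fun y => by
    simp_rw [Finset.sum_mul_sum, Finset.mul_sum]
  rw [Finset.sum_congr rfl fun y _ => hexp y, Finset.sum_comm]
  have : ∀ a : ι, ∑ y : ι → α, ∑ b, (∏ i, w (y i)) * (f (y a) * g (y b)) =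
      (∑ x, w x * (f x * g x)) +
        (Fintype.card ι - 1) * ((∑ x, w x * f x) * ∑ x, w x * g x) := by
    intro a
    rw [Finset.sum_comm]
    simp_rw [sum_prod_weight_mul w hw]
    rw [← Finset.add_sum_erase _ _ (Finset.mem_univ a), if_pos rfl, Finset.sum_congr rfl
      (fun b hb => if_neg (Ne.symm (Finset.ne_of_mem_erase hb))), Finset.sum_const,
      Finset.card_erase_of_mem (Finset.mem_univ a), Finset.card_univ, nsmul_eq_mul,
      Nat.cast_sub (Fintype.card_pos_iff.mpr ⟨a⟩), Nat.cast_one]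
  simp_rw [this, Finset.sum_const, Finset.card_univ, nsmul_eq_mul]
  ring

/-- Chebyshev's inequality for the sum of `card ι` independent copies of `z` under the weight `w`: an
event `Q` that holds whenever the sum is within `δ` of its mean has at least the stated weight. -/
theorem chebyshev_sum (w : α → ℝ) (hw0 : ∀ x, 0 ≤ w x) (hw : ∑ x, w x = 1) (z : α → ℝ)
    {δ : ℝ} (hδ : 0 < δ) (Q : (ι → α) → Prop) [DecidablePred Q]
    (hQ : ∀ y, |∑ i, z (y i) - Fintype.card ι * ∑ x, w x * z x| < δ → Q y) :
    1 - Fintype.card ι * (∑ x, w x * z x ^ 2) / δ ^ 2 ≤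
      ∑ y : ι → α, if Q y then ∏ i, w (y i) else 0 := by
  set μ := ∑ x, w x * z x with hμ
  have hW : ∀ y : ι → α, 0 ≤ ∏ i, w (y i) := fun y => Finset.prod_nonneg fun i _ => hw0 _
  have hpt : ∀ y : ι → α, (∏ i, w (y i)) - (∏ i, w (y i)) *
      ((∑ i, z (y i)) - Fintype.card ι * μ) ^ 2 / δ ^ 2 ≤ if Q y then ∏ i, w (y i) else 0 := by
    intro y
    split_ifs with h
    · have := hW y
      have : 0 ≤ (∏ i, w (y i)) * ((∑ i, z (y i)) - Fintype.card ι * μ) ^ 2 / δ ^ 2 := by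
        positivity
      linarith
    · have hδy : δ ≤ |∑ i, z (y i) - Fintype.card ι * μ| := not_lt.mp fun hlt => h (hQ y hlt)
      have h1 : 1 ≤ ((∑ i, z (y i)) - Fintype.card ι * μ) ^ 2 / δ ^ 2 := by
        rw [one_le_div (by positivity), ← sq_abs ((∑ i, z (y i)) - _)]
        exact pow_le_pow_left₀ hδ.le hδy 2
      rw [mul_div_assoc]
      nlinarith [hW y]
  have hsq : ∑ y : ι → α, (∏ i, w (y i)) * ((∑ i, z (y i)) - Fintype.card ι * μ) ^ 2 =
      Fintype.card ι * (∑ x, w x * z x ^ 2) - Fintype.card ι * μ ^ 2 := by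
    have : ∀ y : ι → α, (∏ i, w (y i)) * ((∑ i, z (y i)) - Fintype.card ι * μ) ^ 2 =
        (∏ i, w (y i)) * ((∑ i, z (y i)) * ∑ i, z (y i)) -
        2 * Fintype.card ι * μ * ((∏ i, w (y i)) * ∑ i, z (y i)) +
        (Fintype.card ι * μ) ^ 2 * ∏ i, w (y i) := fun y => by ring
    simp_rw [this]
    rw [Finset.sum_add_distrib, Finset.sum_sub_distrib, ← Finset.mul_sum, ← Finset.mul_sum,
      sum_prod_weight_mul_sum_mul_sum w hw, sum_prod_weight_mul_sum w hw, sum_prod_weight w hw]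
    simp_rw [← pow_two, ← hμ]
    ring
  refine le_trans ?_ (Finset.sum_le_sum fun y _ => hpt y)
  rw [Finset.sum_sub_distrib, sum_prod_weight w hw, ← Finset.sum_div, hsq]
  gcongr
  nlinarith [mul_nonneg (Nat.cast_nonneg (α := ℝ) (Fintype.card ι)) (sq_nonneg μ)]

end product

section collision

variable {κ : Type*} [Fintype κ] {m : ℕ}

/-- Functions of the two batches are independent. -/
theorem sum_sumArrow (F G : (Fin m → κ) → ℝ) (p : κ → ℝ) :
    ∑ x : Fin m ⊕ Fin m → κ, (∏ i, p (x i)) * (F (x ∘ Sum.inl) * G (x ∘ Sum.inr)) =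
      (∑ x : Fin m → κ, (∏ i, p (x i)) * F x) * ∑ x : Fin m → κ, (∏ i, p (x i)) * G x := by
  rw [Finset.sum_mul_sum, ← Finset.sum_product', Finset.univ_product_univ]
  refine Fintype.sum_equiv (Equiv.sumArrowEquivProdArrow (Fin m) (Fin m) κ) _ _ fun x => ?_
  simp only [Fintype.prod_sum_type, Equiv.sumArrowEquivProdArrow_apply_fst,
    Equiv.sumArrowEquivProdArrow_apply_snd]
  simp only [Function.comp_def]
  change _ = (∏ i, p (x (Sum.inl i))) * F (fun i => x (Sum.inl i)) *
    ((∏ i, p (x (Sum.inr i))) * G (fun i => x (Sum.inr i)))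
  ring

variable [DecidableEq κ]

/-- The deviation of the empirical frequency of `j` in a batch of `m` samples from `q j`. -/
noncomputable def empDev (q : κ → ℝ) (x : Fin m → κ) (j : κ) : ℝ :=
  (∑ i, ((if x i = j then 1 else 0) - q j)) / m

/-- The inner product of the empirical deviations of two independent batches of `m` samples. -/
noncomputable def pairStat (q : κ → ℝ) (x : Fin m ⊕ Fin m → κ) : ℝ :=
  ∑ j, empDev q (x ∘ Sum.inl) j * empDev q (x ∘ Sum.inr) j

theorem sum_weight_mul_dev (p q : κ → ℝ) (hp : ∑ j, p j = 1) (j : κ) :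
    ∑ x, p x * ((if x = j then 1 else 0) - q j) = p j - q j := by
  simp_rw [mul_sub, Finset.sum_sub_distrib, ← Finset.sum_mul, hp]
  simp

theorem expect_empDev (hm : m ≠ 0) (p q : κ → ℝ) (hp : ∑ j, p j = 1) (j : κ) :
    ∑ x : Fin m → κ, (∏ i, p (x i)) * empDev q x j = p j - q j := by
  simp_rw [empDev, ← mul_div_assoc, ← Finset.sum_div]
  rw [sum_prod_weight_mul_sum p hp (fun x => (if x = j then 1 else 0) - q j),
    sum_weight_mul_dev p q hp, Fintype.card_fin]
  field_simp

theorem expect_empDev_mul (hm : m ≠ 0) (p q : κ → ℝ) (hp : ∑ j, p j = 1) (j k : κ) :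
    ∑ x : Fin m → κ, (∏ i, p (x i)) * (empDev q x j * empDev q x k) =
      (p j - q j) * (p k - q k) + ((if j = k then p j else 0) - p j * p k) / m := by
  have h2 : ∑ x, p x * (((if x = j then 1 else 0) - q j) * ((if x = k then 1 else 0) - q k)) =
      (p j - q j) * (p k - q k) + ((if j = k then p j else 0) - p j * p k) := by
    have : ∀ x, p x * (((if x = j then 1 else 0) - q j) * ((if x = k then 1 else 0) - q k)) =
        (if x = j then (if j = k then p x else 0) else 0) - q k * (if x = j then p x else 0)
         - q j * (if x = k then p x else 0) + q j * q k * p x := by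
      intro x
      split_ifs <;> first | (exfalso; grind) | ring
    simp_rw [this, Finset.sum_add_distrib, Finset.sum_sub_distrib, ← Finset.mul_sum, hp]
    simp only [Finset.sum_ite_eq', Finset.mem_univ, if_true]
    ring
  simp_rw [empDev, div_mul_div_comm, ← mul_div_assoc, ← Finset.sum_div]
  rw [sum_prod_weight_mul_sum_mul_sum p hp (fun x => (if x = j then 1 else 0) - q j)
    (fun x => (if x = k then 1 else 0) - q k), h2, sum_weight_mul_dev p q hp,
    sum_weight_mul_dev p q hp, Fintype.card_fin]
  have : (m : ℝ) ≠ 0 := by exact_mod_cast hm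
  field_simp
  ring

/-- The statistic is an unbiased estimator of `‖p - q‖₂²`. -/
theorem expect_pairStat (hm : m ≠ 0) (p q : κ → ℝ) (hp : ∑ j, p j = 1) :
    ∑ x : Fin m ⊕ Fin m → κ, (∏ i, p (x i)) * pairStat q x = ∑ j, (p j - q j) ^ 2 := by
  simp_rw [pairStat, Finset.mul_sum]
  rw [Finset.sum_comm]
  refine Finset.sum_congr rfl fun j _ => ?_
  rw [sum_sumArrow (fun x => empDev q x j) (fun x => empDev q x j), expect_empDev hm p q hp, pow_two]

theorem expect_pairStat_sq_le (hm : m ≠ 0) (p q : κ → ℝ) (hp0 : ∀ j, 0 ≤ p j)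
    (hp : ∑ j, p j = 1) :
    ∑ x : Fin m ⊕ Fin m → κ, (∏ i, p (x i)) * pairStat q x ^ 2 ≤
      2 * (∑ j, (p j - q j) ^ 2) ^ 2 + 3 * (∑ j, p j ^ 2) / m ^ 2 := by
  have h1 : ∑ x : Fin m ⊕ Fin m → κ, (∏ i, p (x i)) * pairStat q x ^ 2 =
      ∑ j, ∑ k, ((p j - q j) * (p k - q k) + ((if j = k then p j else 0) - p j * p k) / m) ^ 2 := by
    have : ∀ x : Fin m ⊕ Fin m → κ, (∏ i, p (x i)) * pairStat q x ^ 2 = ∑ j, ∑ k,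
        (∏ i, p (x i)) * ((empDev q (x ∘ Sum.inl) j * empDev q (x ∘ Sum.inl) k) *
          (empDev q (x ∘ Sum.inr) j * empDev q (x ∘ Sum.inr) k)) := by
      intro x
      rw [pairStat, pow_two, Finset.sum_mul_sum, Finset.mul_sum]
      refine Finset.sum_congr rfl fun j _ => ?_
      rw [Finset.mul_sum]
      exact Finset.sum_congr rfl fun k _ => by ring
    simp_rw [this]
    rw [Finset.sum_comm]
    refine Finset.sum_congr rfl fun j _ => ?_
    rw [Finset.sum_comm]
    refine Finset.sum_congr rfl fun k _ => ?_
    rw [sum_sumArrow (fun x => empDev q x j * empDev q x k)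
      (fun x => empDev q x j * empDev q x k), expect_empDev_mul hm p q hp, pow_two]
  rw [h1]
  set M : ℝ := (m : ℝ)
  have hM : 0 < M := by positivity
  set X := ∑ j, (p j - q j) ^ 2 with hX
  set P := ∑ j, p j ^ 2 with hP
  -- Expand around the rank-one part; the cross terms `2/M ∑ p δ²` are absorbed by AM-GM in `hcross`.
  have hexp : ∀ j k, ((p j - q j) * (p k - q k) + ((if j = k then p j else 0) - p j * p k) / M) ^ 2 =
      (p j - q j) ^ 2 * (p k - q k) ^ 2 - 2 / M * ((p j * (p j - q j)) * (p k * (p k - q k)))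
      + 1 / M ^ 2 * (p j ^ 2 * p k ^ 2)
      + (if j = k then 2 / M * (p j * (p j - q j) ^ 2) + 1 / M ^ 2 * (p j ^ 2 - 2 * p j ^ 3)
          else 0) := by
    intro j k
    split_ifs with h
    · subst h; field_simp; ring
    · field_simp; ring
  simp_rw [hexp, Finset.sum_add_distrib, Finset.sum_sub_distrib, ← Finset.mul_sum, ← Finset.sum_mul,
    ← hX, ← hP]
  simp only [Finset.sum_ite_eq, Finset.mem_univ, if_true]
  simp_rw [Finset.sum_add_distrib, ← Finset.mul_sum, Finset.sum_sub_distrib, ← hP]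
  have hp1 : ∀ j, p j ≤ 1 := fun j => hp ▸ Finset.single_le_sum (fun i _ => hp0 i) (Finset.mem_univ j)
  have hP0 : 0 ≤ P := Finset.sum_nonneg fun j _ => sq_nonneg _
  have hP1 : P ≤ 1 := by
    rw [← hp]
    exact Finset.sum_le_sum fun j _ => by nlinarith [hp0 j, hp1 j]
  have hcross : 2 / M * ∑ j, p j * (p j - q j) ^ 2 ≤ X ^ 2 + P / M ^ 2 := by
    have hX2 : ∑ j, (p j - q j) ^ 4 ≤ X ^ 2 := by
      simpa only [← pow_mul] using
        Finset.sum_sq_le_sq_sum_of_nonneg (s := Finset.univ) (f := fun j => (p j - q j) ^ 2) fun j _ => sq_nonneg _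
    refine le_trans ?_ (add_le_add_left hX2 _)
    rw [hP, Finset.mul_sum, Finset.sum_div, ← Finset.sum_add_distrib]
    refine Finset.sum_le_sum fun j _ => ?_
    have : 0 ≤ ((p j - q j) ^ 2 - p j / M) ^ 2 := sq_nonneg _
    calc _ = (p j - q j) ^ 4 + p j ^ 2 / M ^ 2 - ((p j - q j) ^ 2 - p j / M) ^ 2 := by
          field_simp; ring
      _ ≤ _ := by linarith
  have h3 : 0 ≤ ∑ j, 2 * p j ^ 3 := Finset.sum_nonneg fun j _ => by have := hp0 j; positivity
  have hdrop : 0 ≤ 2 / M * ((∑ j, p j * (p j - q j)) * ∑ j, p j * (p j - q j)) :=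
    mul_nonneg (by positivity) (mul_self_nonneg _)
  have hlast : 1 / M ^ 2 * (P * P) + 1 / M ^ 2 * (P - ∑ j, 2 * p j ^ 3) ≤ 2 * P / M ^ 2 := by
    rw [← mul_add, one_div_mul_eq_div]
    gcongr
    nlinarith
  have : 3 * P / M ^ 2 = P / M ^ 2 + 2 * P / M ^ 2 := by ring
  simp only [← Finset.mul_sum] at *
  nlinarith

end collision

/-! ### Orthogonal sign matrices, and superoperators probed by random vectors -/

theorem sum_prod_signs_mul {k : ℕ} (A B : Finset (Fin k)) :
    ∑ x : Fin k → ℤˣ, ((∏ i ∈ A, x i : ℤˣ) : ℝ) * ((∏ i ∈ B, x i : ℤˣ) : ℝ) =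
      if A = B then (2 : ℝ) ^ k else 0 := by
  split_ifs with h
  · subst h
    have : ∀ u : ℤˣ, ((u : ℤ) : ℝ) * ((u : ℤ) : ℝ) = 1 := fun u => by
      rw [← Int.cast_mul, Int.units_coe_mul_self, Int.cast_one]
    push_cast
    simp_rw [← Finset.prod_mul_distrib, this]
    simp
  · have hflip : ∀ (A : Finset (Fin k)) (i : Fin k) (s : Fin k → ℤˣ),
        ∏ j ∈ A, Function.update s i (-s i) j = if i ∈ A then -∏ j ∈ A, s j else ∏ j ∈ A, s j := by
      intro A i s
      split_ifs with hi
      · rw [Finset.prod_update_of_mem hi, neg_mul, ← Finset.erase_eq, Finset.mul_prod_erase _ _ hi]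
      · rw [Finset.prod_update_of_notMem hi]
    obtain ⟨i, hi⟩ : ∃ i, ¬(i ∈ A ↔ i ∈ B) := by
      by_contra hcon
      push Not at hcon
      exact h (Finset.ext hcon)
    rw [← Fintype.card_smul_expect, expect_eq_zero_of_flip i, smul_zero]
    intro s
    rw [hflip, hflip]
    by_cases hA : i ∈ A <;> by_cases hB : i ∈ B <;> simp_all

/-- A sign matrix with orthogonal columns indexed by `ι` and at most `2 * card ι` rows: a set of
columns of a Walsh–Hadamard matrix. -/
theorem exists_orthogonal_signs (ι : Type*) [Fintype ι] [Nonempty ι] [DecidableEq ι] :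
    ∃ K : ℕ, 0 < K ∧ K ≤ 2 * Fintype.card ι ∧ ∃ H : Fin K → ι → ℤˣ,
      ∀ a b, ∑ j, ((H j a : ℤ) : ℝ) * ((H j b : ℤ) : ℝ) = if a = b then (K : ℝ) else 0 := by
  set k := Nat.log 2 (Fintype.card ι) + 1
  have hlt : Fintype.card ι < 2 ^ k := Nat.lt_pow_succ_log_self one_lt_two _
  have hle : 2 ^ k ≤ 2 * Fintype.card ι := by
    rw [pow_succ, mul_comm]
    exact Nat.mul_le_mul_left 2 (Nat.pow_log_le_self 2 Fintype.card_ne_zero)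
  obtain ⟨φ⟩ : Nonempty (ι ↪ Finset (Fin k)) :=
    Function.Embedding.nonempty_of_card_le (by simpa using hlt.le)
  have hcard : Fintype.card (Fin k → ℤˣ) = 2 ^ k := by simp
  refine ⟨2 ^ k, by positivity, hle,
    fun j a => ∏ i ∈ φ a, (Fintype.equivFinOfCardEq hcard).symm j i, fun a b => ?_⟩
  rw [Fintype.sum_equiv (Fintype.equivFinOfCardEq hcard).symm _ (fun x : Fin k → ℤˣ =>
    ((∏ i ∈ φ a, x i : ℤˣ) : ℝ) * ((∏ i ∈ φ b, x i : ℤˣ) : ℝ)) fun j => rfl, sum_prod_signs_mul]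
  simp

section operators

variable {din dout : ℕ}

/-- The unnormalized pure state `v v†` of the random vector `v = signVec s`. -/
noncomputable def signInput (s : Fin din × Fin 3 → ℤˣ) : Matrix (Fin din) (Fin din) ℂ :=
  Matrix.vecMulVec (signVec s) (star (signVec s))

/-- `u† L(v v†) u` for `v = signVec s` and `u = signVec t`. -/
noncomputable def signForm (L : Superop din dout) (s : Fin din × Fin 3 → ℤˣ)
    (t : Fin dout × Fin 3 → ℤˣ) : ℂ :=
  ∑ a, ∑ b, star (signVec t a) * L (signInput s) a b * signVec t b

/-- `∑ ‖L(E_xy)_ab‖²`, which is `din²` times the squared Frobenius norm of the Choi operator. -/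
noncomputable def superopNormSq (L : Superop din dout) : ℝ :=
  ∑ x, ∑ y, ∑ a, ∑ b, ‖L (Matrix.single x y 1) a b‖ ^ 2

theorem apply_signInput (L : Superop din dout) (s : Fin din × Fin 3 → ℤˣ) (a b : Fin dout) :
    L (signInput s) a b =
      ∑ y, ∑ x, star (signVec s y) * L (Matrix.single x y 1) a b * signVec s x := by
  conv_lhs => rw [Matrix.matrix_eq_sum_single (signInput s)]
  simp_rw [map_sum, Matrix.sum_apply]
  rw [Finset.sum_comm]
  refine Finset.sum_congr rfl fun y _ => Finset.sum_congr rfl fun x _ => ?_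
  have : Matrix.single x y (signInput s x y) = signInput s x y • Matrix.single x y (1 : ℂ) := by
    simp
  rw [this, map_smul, Matrix.smul_apply, signInput, Matrix.vecMulVec_apply, smul_eq_mul]
  simp only [Pi.star_apply]
  ring

/-- Two applications of `le_expect_signVec_quadForm`: to the matrix `L(v v†)`, and then to each of its
entries as a quadratic form in `v`. -/
theorem le_expect_signForm (L : Superop din dout) :
    64 * superopNormSq L ≤ 𝔼 s, 𝔼 t, ‖signForm L s t‖ ^ 2 := by
  have h1 : ∀ s, 8 * ∑ a, ∑ b, ‖L (signInput s) a b‖ ^ 2 ≤ 𝔼 t, ‖signForm L s t‖ ^ 2 :=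
    fun s => le_expect_signVec_quadForm fun a b => L (signInput s) a b
  refine le_trans ?_ (Finset.expect_le_expect fun s _ => h1 s)
  rw [← Finset.mul_expect]
  simp_rw [Finset.expect_sum_comm]
  have h2 : ∀ a b, 8 * ∑ y, ∑ x, ‖L (Matrix.single x y 1) a b‖ ^ 2 ≤
      𝔼 s, ‖L (signInput s) a b‖ ^ 2 := fun a b => by
    simp_rw [apply_signInput]
    exact le_expect_signVec_quadForm fun y x => L (Matrix.single x y 1) a b
  have h3 : superopNormSq L = ∑ a, ∑ b, ∑ y, ∑ x, ‖L (Matrix.single x y 1) a b‖ ^ 2 := by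
    rw [superopNormSq]
    simp_rw [Finset.sum_comm (γ := Fin din) (α := Fin dout)]
    exact Finset.sum_congr rfl fun a _ => Finset.sum_congr rfl fun b _ => Finset.sum_comm
  have h4 : 8 * superopNormSq L ≤ ∑ a, ∑ b, 𝔼 s, ‖L (signInput s) a b‖ ^ 2 := by
    rw [h3, Finset.mul_sum]
    refine Finset.sum_le_sum fun a _ => ?_
    rw [Finset.mul_sum]
    exact Finset.sum_le_sum fun b _ => h2 a b
  linarith

theorem choi_apply (L : Superop din dout) (a b : Fin dout × Fin din) :
    choi L a b = 1 / (din : ℂ) * L (Matrix.single a.2 b.2 1) a.1 b.1 := by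
  have : (Matrix.of fun i j => maxEntangled din (i, a.2) (j, b.2)) =
      (1 / (din : ℂ)) • Matrix.single a.2 b.2 (1 : ℂ) := by
    ext i j
    simp [maxEntangled, Matrix.single_apply, eq_comm]
  rw [choi, ampliation, Matrix.of_apply, this, map_smul, Matrix.smul_apply, smul_eq_mul]

theorem acidNorm_sq_le (hd : 0 < din) (L : Superop din dout) :
    acidNorm L ^ 2 ≤ dout / din * superopNormSq L := by
  refine (traceNorm_sq_le (choi L)).trans (le_of_eq ?_)
  have hd' : (din : ℝ) ≠ 0 := by positivity
  have h : ∑ i, ∑ j, ‖choi L i j‖ ^ 2 = 1 / (din : ℝ) ^ 2 * superopNormSq L := by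
    simp_rw [choi_apply, norm_mul, mul_pow, ← Finset.mul_sum, Fintype.sum_prod_type]
    congr 1
    · simp
    · rw [superopNormSq]
      simp_rw [Finset.sum_comm (γ := Fin din) (α := Fin dout)]
  rw [h]
  simp
  field_simp

theorem IsChannel.posSemidef {M : Superop din dout} (hM : IsChannel M)
    {A : Matrix (Fin din) (Fin din) ℂ} (hA : A.PosSemidef) : (M A).PosSemidef := by
  have h := hM.completelyPositive 1 _ (hA.submatrix (Prod.fst : Fin din × Fin 1 → Fin din))
  exact h.submatrix fun a : Fin dout => (a, (0 : Fin 1))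

theorem signInput_posSemidef (s : Fin din × Fin 3 → ℤˣ) : (signInput s).PosSemidef :=
  Matrix.posSemidef_vecMulVec_self_star _

theorem norm_sq_sum_le_trace_sq {n : Type*} [Fintype n] [DecidableEq n] {ρ : Matrix n n ℂ}
    (hρ : ρ.PosSemidef) : ∑ a, ∑ b, ‖ρ a b‖ ^ 2 ≤ ρ.trace.re ^ 2 := by
  obtain ⟨m, v, rfl⟩ := Matrix.posSemidef_iff_eq_sum_vecMulVec.mp hρ
  have htr : (∑ k, Matrix.vecMulVec (v k) (star (v k))).trace.re = ∑ a, ∑ k, ‖v k a‖ ^ 2 := by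
    simp [Matrix.trace, Matrix.sum_apply, Matrix.vecMulVec_apply, Complex.mul_conj',
      ← Complex.ofReal_pow]
  rw [htr, pow_two, Finset.sum_mul_sum]
  refine Finset.sum_le_sum fun a _ => Finset.sum_le_sum fun b _ => ?_
  simp only [Matrix.sum_apply, Matrix.vecMulVec_apply, Pi.star_apply]
  calc _ ≤ (∑ k, ‖v k a‖ * ‖v k b‖) ^ 2 := by
        gcongr
        refine (norm_sum_le _ _).trans (le_of_eq ?_)
        simp
    _ ≤ _ := Finset.sum_mul_sq_le_sq_mul_sq _ _ _

theorem IsChannel.signForm_nonneg {M : Superop din dout} (hM : IsChannel M)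
    (s : Fin din × Fin 3 → ℤˣ) (t : Fin dout × Fin 3 → ℤˣ) : 0 ≤ signForm M s t := by
  have h := (hM.posSemidef (signInput_posSemidef s)).dotProduct_mulVec_nonneg (signVec t)
  simpa [signForm, dotProduct, Matrix.mulVec, Finset.mul_sum, mul_assoc] using h

/-- The squared Euclidean norm of `signVec s`. -/
noncomputable def signNormSq {n : ℕ} (s : Fin n × Fin 3 → ℤˣ) : ℝ := ∑ x, ‖signVec s x‖ ^ 2

theorem signNormSq_le {n : ℕ} (s : Fin n × Fin 3 → ℤˣ) : signNormSq s ≤ 10 * n := by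
  refine (Finset.sum_le_sum fun x _ => (norm_signVec_sq_bounds s x).2).trans (le_of_eq ?_)
  simp [mul_comm]

theorem signNormSq_pos {n : ℕ} (hn : 0 < n) (s : Fin n × Fin 3 → ℤˣ) : 0 < signNormSq s :=
  Finset.sum_pos (fun x _ => two_pos.trans_le (norm_signVec_sq_bounds s x).1)
    ⟨⟨0, hn⟩, Finset.mem_univ _⟩

theorem trace_signInput (s : Fin din × Fin 3 → ℤˣ) : (signInput s).trace = (signNormSq s : ℂ) := by
  simp [signInput, signNormSq, Matrix.trace, Matrix.vecMulVec_apply, Complex.mul_conj']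

/-- Random signs flatten the outcome distribution of any output state. -/
theorem IsChannel.expect_signForm_sq_le {M : Superop din dout} (hM : IsChannel M)
    (s : Fin din × Fin 3 → ℤˣ) : 𝔼 t, ‖signForm M s t‖ ^ 2 ≤ 108 * signNormSq s ^ 2 := by
  refine (expect_signVec_quadForm_le fun a b => M (signInput s) a b).trans ?_
  have htr : (M (signInput s)).trace = (signNormSq s : ℂ) := by
    rw [hM.tracePreserving, trace_signInput]
  have h1 : ‖∑ x, M (signInput s) x x‖ ^ 2 = signNormSq s ^ 2 := by
    change ‖(M (signInput s)).trace‖ ^ 2 = _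
    rw [htr, Complex.norm_real, Real.norm_eq_abs, sq_abs]
  have h2 := norm_sq_sum_le_trace_sq (hM.posSemidef (signInput_posSemidef s))
  rw [htr, Complex.ofReal_re] at h2
  linarith

theorem signForm_sub (M N : Superop din dout) (s : Fin din × Fin 3 → ℤˣ)
    (t : Fin dout × Fin 3 → ℤˣ) : signForm (M - N) s t = signForm M s t - signForm N s t := by
  simp only [signForm, LinearMap.sub_apply, Matrix.sub_apply, mul_sub, sub_mul,
    Finset.sum_sub_distrib]

/-- Hypercontractivity for the degree-four polynomial `u† L(v v†) u`. -/
theorem expect_re_signForm_pow_four_le (L : Superop din dout) :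
    𝔼 s, 𝔼 t, (signForm L s t).re ^ 4 ≤ 6561 * (𝔼 s, 𝔼 t, (signForm L s t).re ^ 2) ^ 2 := by
  set ι := (Fin din × Fin 3) ⊕ (Fin dout × Fin 3)
  set n := Fintype.card ι
  set e : ι ≃ Fin n := Fintype.equivFin ι
  set G : (Fin n → ℤˣ) → ℂ := fun ξ =>
    signForm L (fun i => ξ (e (Sum.inl i))) (fun i => ξ (e (Sum.inr i))) with hG
  have hexp : ∀ F : ℂ → ℝ, 𝔼 s, 𝔼 t, F (signForm L s t) = 𝔼 ξ, F (G ξ) := fun F => by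
    rw [← Finset.expect_product', Finset.univ_product_univ]
    refine (Fintype.expect_equiv ((Equiv.arrowCongr e.symm (Equiv.refl ℤˣ)).trans
      (Equiv.sumArrowEquivProdArrow _ _ _)) _ _ fun ξ => ?_).symm
    rfl
  have hlin : ∀ {m : ℕ} (j : Fin m × Fin 3 → Fin n) (x : Fin m) (d : ℕ) (f : (Fin n → ℤˣ) → ℂ)
      (c : Fin 3 → ℂ), LowDeg n d f →
      LowDeg n (d + 1) fun ξ => (∑ i, c i * ((ξ (j (x, i)) : ℤ) : ℂ)) * f ξ := by
    intro m j x d f c hf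
    simp_rw [Finset.sum_mul, mul_assoc]
    exact LowDeg.sum _ fun i _ => (hf.sign_mul _).const_mul _
  have hstar : ∀ {m : ℕ} (s : Fin m × Fin 3 → ℤˣ) (x : Fin m), star (signVec s x) =
      ∑ c, star (signCoeff c) * ((s (x, c) : ℤ) : ℂ) := fun s x => by
    simp [signVec]
  have hdeg : LowDeg n 4 G := by
    simp_rw [hG, signForm, apply_signInput, Finset.mul_sum, Finset.sum_mul]
    refine LowDeg.sum _ fun a _ => LowDeg.sum _ fun b _ => LowDeg.sum _ fun y _ =>
      LowDeg.sum _ fun x _ => ?_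
    have h := hlin (fun i => e (Sum.inr i)) a 3 _ (fun c => star (signCoeff c)) <|
      hlin (fun i => e (Sum.inl i)) y 2 _ (fun c => star (signCoeff c)) <|
      hlin (fun i => e (Sum.inl i)) x 1 _ signCoeff <|
      hlin (fun i => e (Sum.inr i)) b 0 _ signCoeff <|
      LowDeg.const (L (Matrix.single x y 1) a b) n 0
    convert h using 2 with ξ
    rw [hstar, hstar, signVec, signVec]
    ring
  rw [hexp fun z => z.re ^ 4, hexp fun z => z.re ^ 2]
  exact hdeg.re.expect_pow_four_le.trans (le_of_eq (by norm_num))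

end operators

/-! ### The randomized measurement and its moments -/

section measurement

variable {din dout K : ℕ}

/-- The measurement with outcomes `j : Fin K` and elements `u_j u_j† / (6 K)`, where the signs of `u_j`
are those of `t` multiplied by row `j` of `H`. -/
noncomputable def signPovm (H : Fin K → Fin dout × Fin 3 → ℤˣ) (t : Fin dout × Fin 3 → ℤˣ)
    (j : Fin K) : Matrix (Fin dout) (Fin dout) ℂ :=
  (1 / (6 * (K : ℂ))) • signInput (H j * t)

theorem signPovm_posSemidef (H : Fin K → Fin dout × Fin 3 → ℤˣ) (t : Fin dout × Fin 3 → ℤˣ)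
    (j : Fin K) : (signPovm H t j).PosSemidef := by
  refine (signInput_posSemidef _).smul ?_
  have : (1 / (6 * (K : ℂ))) = ((1 / (6 * (K : ℝ)) : ℝ) : ℂ) := by push_cast; rfl
  rw [this]
  exact_mod_cast (by positivity : (0 : ℝ) ≤ 1 / (6 * (K : ℝ)))

/-- Completeness: the orthogonality of the columns of `H` leaves only the terms with equal signs, and
`6` is the squared norm of `signCoeff`. -/
theorem sum_signPovm (hK : 0 < K) {H : Fin K → Fin dout × Fin 3 → ℤˣ}
    (hH : ∀ a b, ∑ j, ((H j a : ℤ) : ℝ) * ((H j b : ℤ) : ℝ) = if a = b then (K : ℝ) else 0)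
    (t : Fin dout × Fin 3 → ℤˣ) : ∑ j, signPovm H t j = 1 := by
  have hHc : ∀ a b, ∑ j, ((H j a : ℤ) : ℂ) * ((H j b : ℤ) : ℂ) = if a = b then (K : ℂ) else 0 :=
    fun a b => by
      have := congrArg (fun r : ℝ => (r : ℂ)) (hH a b)
      push_cast at this
      simpa [apply_ite] using this
  have hsq : ∀ i, ((t i : ℤ) : ℂ) * ((t i : ℤ) : ℂ) = 1 := fun i => by
    rw [← Int.cast_mul, Int.units_coe_mul_self, Int.cast_one]
  have hK' : (K : ℂ) ≠ 0 := by exact_mod_cast hK.ne'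
  ext a b
  have key : ∑ j, signVec (H j * t) a * star (signVec (H j * t) b) =
      ∑ c, ∑ c', signCoeff c * star (signCoeff c') * (((t (a, c) : ℤ) : ℂ) * ((t (b, c') : ℤ) : ℂ)) *
        ∑ j, ((H j (a, c) : ℤ) : ℂ) * ((H j (b, c') : ℤ) : ℂ) := by
    simp_rw [Finset.mul_sum, signVec, star_sum, Finset.sum_mul_sum]
    rw [Finset.sum_comm]
    refine Finset.sum_congr rfl fun c _ => ?_
    rw [Finset.sum_comm]
    refine Finset.sum_congr rfl fun c' _ => Finset.sum_congr rfl fun j _ => ?_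
    simp only [star_mul', Complex.star_def, map_intCast, Pi.mul_apply, Units.val_mul, Int.cast_mul]
    ring
  simp_rw [hHc] at key
  simp only [Matrix.sum_apply, signPovm, Matrix.smul_apply, smul_eq_mul, signInput,
    Matrix.vecMulVec_apply, Pi.star_apply, ← Finset.mul_sum]
  rw [key, Matrix.one_apply]
  by_cases hab : a = b
  · subst hab
    have h6 := sum_star_signCoeff_mul_self
    simp only [Prod.mk.injEq, true_and, mul_ite, mul_zero, Finset.sum_ite_eq, Finset.mem_univ,
      if_true, hsq, mul_one]
    simp_rw [mul_comm (signCoeff _), ← Finset.sum_mul, h6]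
    field_simp
  · simp [hab]

theorem trace_signInput_mul (v : Fin dout × Fin 3 → ℤˣ) (A : Matrix (Fin dout) (Fin dout) ℂ) :
    (signInput v * A).trace = ∑ a, ∑ b, star (signVec v a) * A a b * signVec v b := by
  simp only [Matrix.trace, Matrix.diag, Matrix.mul_apply, signInput, Matrix.vecMulVec_apply,
    Pi.star_apply]
  rw [Finset.sum_comm]
  refine Finset.sum_congr rfl fun a _ => Finset.sum_congr rfl fun b _ => by ring

/-- The normalized random input vector. -/
noncomputable def signKet (s : Fin din × Fin 3 → ℤˣ) : EuclideanSpace ℂ (Fin din) :=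
  ((1 / Real.sqrt (signNormSq s) : ℝ) : ℂ) • WithLp.toLp 2 (signVec s)

theorem norm_signKet (hd : 0 < din) (s : Fin din × Fin 3 → ℤˣ) : ‖signKet s‖ = 1 := by
  have h := signNormSq_pos hd s
  have hn : ‖(WithLp.toLp 2 (signVec s) : EuclideanSpace ℂ (Fin din))‖ = √(signNormSq s) := by
    rw [EuclideanSpace.norm_eq]
    rfl
  rw [signKet, norm_smul, hn, Complex.norm_real, Real.norm_eq_abs, abs_of_nonneg (by positivity)]
  have := Real.sqrt_pos.mpr h
  field_simp

theorem vecMulVec_signKet (hd : 0 < din) (s : Fin din × Fin 3 → ℤˣ) :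
    Matrix.vecMulVec (signKet s).ofLp (star (signKet s).ofLp) =
      ((1 / signNormSq s : ℝ) : ℂ) • signInput s := by
  have h := signNormSq_pos hd s
  have hsq : (1 / √(signNormSq s)) * (1 / √(signNormSq s)) = 1 / signNormSq s := by
    rw [div_mul_div_comm, Real.mul_self_sqrt h.le, one_mul]
  ext x y
  simp only [signKet, WithLp.ofLp_smul, Matrix.vecMulVec_apply, Pi.smul_apply, Pi.star_apply,
    smul_eq_mul, star_mul', Complex.star_def, Complex.conj_ofReal, Matrix.smul_apply, signInput]
  rw [← hsq]
  push_cast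
  ring

/-- The outcome distribution for the channel `M`, with the input given by the signs `ω.1` and the
measurement by the signs `ω.2`. -/
noncomputable def signProb (H : Fin K → Fin dout × Fin 3 → ℤˣ) (M : Superop din dout)
    (ω : (Fin din × Fin 3 → ℤˣ) × (Fin dout × Fin 3 → ℤˣ)) (j : Fin K) : ℝ :=
  (signForm M ω.1 (H j * ω.2)).re / (6 * K * signNormSq ω.1)

theorem trace_signPovm_mul (H : Fin K → Fin dout × Fin 3 → ℤˣ) (hd : 0 < din) (M : Superop din dout)
    (ω : (Fin din × Fin 3 → ℤˣ) × (Fin dout × Fin 3 → ℤˣ)) (j : Fin K) :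
    ((signPovm H ω.2 j * M (Matrix.vecMulVec (signKet ω.1).ofLp (star (signKet ω.1).ofLp))).trace).re
      = signProb H M ω j := by
  rw [vecMulVec_signKet hd, map_smul, signPovm, Matrix.smul_mul, Matrix.mul_smul,
    Matrix.trace_smul, Matrix.trace_smul, trace_signInput_mul, smul_eq_mul, smul_eq_mul, ← mul_assoc]
  have : (1 / (6 * (K : ℂ))) * ((1 / signNormSq ω.1 : ℝ) : ℂ) =
      ((1 / (6 * K * signNormSq ω.1) : ℝ) : ℂ) := by
    push_cast
    rw [div_mul_div_comm, one_mul]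
  rw [this, Complex.re_ofReal_mul, signProb, signForm, one_div_mul_eq_div]

theorem IsChannel.signProb_nonneg {M : Superop din dout} (hM : IsChannel M)
    (H : Fin K → Fin dout × Fin 3 → ℤˣ)
    (ω : (Fin din × Fin 3 → ℤˣ) × (Fin dout × Fin 3 → ℤˣ)) (j : Fin K) : 0 ≤ signProb H M ω j :=
  div_nonneg (Complex.nonneg_iff.mp (hM.signForm_nonneg _ _)).1
    (mul_nonneg (by positivity) (Finset.sum_nonneg fun _ _ => sq_nonneg _))

theorem IsChannel.sum_signProb {M : Superop din dout} (hM : IsChannel M) (hd : 0 < din) (hK : 0 < K)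
    {H : Fin K → Fin dout × Fin 3 → ℤˣ}
    (hH : ∀ a b, ∑ j, ((H j a : ℤ) : ℝ) * ((H j b : ℤ) : ℝ) = if a = b then (K : ℝ) else 0)
    (ω : (Fin din × Fin 3 → ℤˣ) × (Fin dout × Fin 3 → ℤˣ)) : ∑ j, signProb H M ω j = 1 := by
  simp_rw [← trace_signPovm_mul H hd]
  rw [← Complex.re_sum, ← Matrix.trace_sum, ← Finset.sum_mul, sum_signPovm hK hH, one_mul,
    hM.tracePreserving, vecMulVec_signKet hd, Matrix.trace_smul, trace_signInput, smul_eq_mul,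
    ← Complex.ofReal_mul, Complex.ofReal_re, one_div_mul_cancel (signNormSq_pos hd _).ne']

/-- A choice of signs for the input state and for the measurement. -/
abbrev SignSetting (din dout : ℕ) : Type := (Fin din × Fin 3 → ℤˣ) × (Fin dout × Fin 3 → ℤˣ)

/-- Each outcome alone sees uniformly random signs. -/
theorem expect_sum_rows (H : Fin K → Fin dout × Fin 3 → ℤˣ)
    (F : (Fin dout × Fin 3 → ℤˣ) → ℝ) :
    𝔼 t, ∑ j, F (H j * t) = K * 𝔼 t, F t := by
  rw [Finset.expect_sum_comm]
  have : ∀ j, 𝔼 t, F (H j * t) = 𝔼 t, F t := fun j =>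
    Fintype.expect_equiv (Equiv.mulLeft (H j)) _ _ fun t => rfl
  simp_rw [this]
  simp

/-- The probability of a uniformly random setting together with two batches of outcomes. -/
noncomputable def blockWeight (H : Fin K → Fin dout × Fin 3 → ℤˣ) (M : Superop din dout) {m : ℕ}
    (y : SignSetting din dout × (Fin m ⊕ Fin m → Fin K)) : ℝ :=
  (Fintype.card (SignSetting din dout) : ℝ)⁻¹ * ∏ i, signProb H M y.1 (y.2 i)

/-- The collision statistic of a block, scaled by `‖v‖⁴` so that its mean in a given setting is
polynomial in the signs. -/
noncomputable def blockStat (H : Fin K → Fin dout × Fin 3 → ℤˣ) (N : Superop din dout) {m : ℕ}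
    (y : SignSetting din dout × (Fin m ⊕ Fin m → Fin K)) : ℝ :=
  signNormSq y.1.1 ^ 2 * pairStat (signProb H N y.1) y.2

theorem sum_blockWeight_mul (H : Fin K → Fin dout × Fin 3 → ℤˣ) (M : Superop din dout) {m : ℕ}
    (g : SignSetting din dout → (Fin m ⊕ Fin m → Fin K) → ℝ) :
    ∑ y : SignSetting din dout × (Fin m ⊕ Fin m → Fin K), blockWeight H M y * g y.1 y.2 =
      𝔼 ω, ∑ x, (∏ i, signProb H M ω (x i)) * g ω x := by
  rw [Fintype.sum_prod_type, Fintype.expect_eq_sum_div_card, div_eq_inv_mul, Finset.mul_sum]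
  refine Finset.sum_congr rfl fun ω _ => ?_
  rw [Finset.mul_sum]
  exact Finset.sum_congr rfl fun x _ => by rw [blockWeight, mul_assoc]

theorem expect_setting (F : SignSetting din dout → ℝ) : 𝔼 ω, F ω = 𝔼 s, 𝔼 t, F (s, t) := by
  rw [← Finset.univ_product_univ, Finset.expect_product]

variable {M N : Superop din dout} {m : ℕ} {H : Fin K → Fin dout × Fin 3 → ℤˣ}

theorem sq_mul_sum_sq_sub_signProb (hd : 0 < din) (H : Fin K → Fin dout × Fin 3 → ℤˣ)
    (M N : Superop din dout) (s : Fin din × Fin 3 → ℤˣ) (t : Fin dout × Fin 3 → ℤˣ) :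
    signNormSq s ^ 2 * ∑ j, (signProb H M (s, t) j - signProb H N (s, t) j) ^ 2 =
      1 / (6 * K) ^ 2 * ∑ j, (signForm (M - N) s (H j * t)).re ^ 2 := by
  have := (signNormSq_pos hd s).ne'
  rw [Finset.mul_sum, Finset.mul_sum]
  refine Finset.sum_congr rfl fun j _ => ?_
  rw [signForm_sub, Complex.sub_re]
  simp only [signProb]
  rw [← sub_div, div_pow, mul_pow (6 * (K : ℝ)), mul_comm ((6 * (K : ℝ)) ^ 2), ← mul_div_assoc,
    mul_div_mul_left _ _ (pow_ne_zero 2 this), one_div_mul_eq_div]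

theorem sum_blockWeight_mul_blockStat (hM : IsChannel M) (hd : 0 < din) (hK : 0 < K) (hm : m ≠ 0)
    (hH : ∀ a b, ∑ j, ((H j a : ℤ) : ℝ) * ((H j b : ℤ) : ℝ) = if a = b then (K : ℝ) else 0) :
    ∑ y : SignSetting din dout × (Fin m ⊕ Fin m → Fin K), blockWeight H M y * blockStat H N y =
      (𝔼 s, 𝔼 t, (signForm (M - N) s t).re ^ 2) / (36 * K) := by
  have hK' : (K : ℝ) ≠ 0 := by positivity
  have h1 : ∀ ω : SignSetting din dout, ∑ x : Fin m ⊕ Fin m → Fin K, (∏ i, signProb H M ω (x i)) *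
      (signNormSq ω.1 ^ 2 * pairStat (signProb H N ω) x) =
      signNormSq ω.1 ^ 2 * ∑ j, (signProb H M ω j - signProb H N ω j) ^ 2 := fun ω => by
    simp_rw [mul_left_comm _ (signNormSq ω.1 ^ 2), ← Finset.mul_sum]
    rw [expect_pairStat hm _ _ (hM.sum_signProb hd hK hH ω)]
  refine (sum_blockWeight_mul H M
    (fun ω x => signNormSq ω.1 ^ 2 * pairStat (signProb H N ω) x)).trans ?_
  simp_rw [h1, expect_setting, sq_mul_sum_sq_sub_signProb hd, ← Finset.mul_expect]
  have h2 : ∀ s, 𝔼 t, ∑ j, (signForm (M - N) s (H j * t)).re ^ 2 =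
      K * 𝔼 t, (signForm (M - N) s t).re ^ 2 :=
    fun s => expect_sum_rows H fun t => (signForm (M - N) s t).re ^ 2
  simp_rw [h2, ← Finset.mul_expect]
  field_simp
  ring

/-- The first term is the signal, by hypercontractivity; the second is the sampling noise, by
flatness. -/
theorem sum_blockWeight_mul_blockStat_sq_le (hM : IsChannel M) (hd : 0 < din) (hK : 0 < K)
    (hm : m ≠ 0)
    (hH : ∀ a b, ∑ j, ((H j a : ℤ) : ℝ) * ((H j b : ℤ) : ℝ) = if a = b then (K : ℝ) else 0) :
    ∑ y : SignSetting din dout × (Fin m ⊕ Fin m → Fin K), blockWeight H M y * blockStat H N y ^ 2 ≤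
      13122 * ((𝔼 s, 𝔼 t, (signForm (M - N) s t).re ^ 2) / (36 * K)) ^ 2 +
        90000 * (din : ℝ) ^ 4 / (K * m ^ 2) := by
  have hKpos : (0 : ℝ) < K := by positivity
  have hmpos : (0 : ℝ) < m := by positivity
  have h1 : ∀ ω : SignSetting din dout, ∑ x : Fin m ⊕ Fin m → Fin K, (∏ i, signProb H M ω (x i)) *
      (signNormSq ω.1 ^ 2 * pairStat (signProb H N ω) x) ^ 2 ≤
      2 * (signNormSq ω.1 ^ 2 * ∑ j, (signProb H M ω j - signProb H N ω j) ^ 2) ^ 2 +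
        3 / m ^ 2 * (signNormSq ω.1 ^ 4 * ∑ j, signProb H M ω j ^ 2) := fun ω => by
    simp_rw [mul_pow, mul_left_comm _ ((signNormSq ω.1 ^ 2) ^ 2), ← Finset.mul_sum]
    refine (mul_le_mul_of_nonneg_left (expect_pairStat_sq_le hm _ (signProb H N ω)
      (hM.signProb_nonneg H ω) (hM.sum_signProb hd hK hH ω)) (by positivity)).trans (le_of_eq ?_)
    ring
  have hX : ∀ s t, (signNormSq s ^ 2 *
      ∑ j, (signProb H M (s, t) j - signProb H N (s, t) j) ^ 2) ^ 2 ≤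
      K / (6 * K) ^ 4 * ∑ j, (signForm (M - N) s (H j * t)).re ^ 4 := fun s t => by
    rw [sq_mul_sum_sq_sub_signProb hd, mul_pow]
    have := sq_sum_le_card_mul_sum_sq (s := Finset.univ)
      (f := fun j => (signForm (M - N) s (H j * t)).re ^ 2)
    simp only [← pow_mul, Finset.card_univ, Fintype.card_fin] at this
    refine (mul_le_mul_of_nonneg_left this (by positivity)).trans (le_of_eq ?_)
    ring
  have hP : ∀ s t, signNormSq s ^ 4 * ∑ j, signProb H M (s, t) j ^ 2 =
      signNormSq s ^ 2 / (6 * K) ^ 2 * ∑ j, ‖signForm M s (H j * t)‖ ^ 2 := fun s t => by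
    have := (signNormSq_pos hd s).ne'
    rw [Finset.mul_sum, Finset.mul_sum]
    refine Finset.sum_congr rfl fun j _ => ?_
    have h0 := Complex.nonneg_iff.mp (hM.signForm_nonneg s (H j * t))
    have : ‖signForm M s (H j * t)‖ = (signForm M s (H j * t)).re :=
      (Complex.re_eq_norm.mpr (hM.signForm_nonneg s (H j * t))).symm
    rw [this, signProb]
    field_simp
  refine (sum_blockWeight_mul H M
    (fun ω x => (signNormSq ω.1 ^ 2 * pairStat (signProb H N ω) x) ^ 2)).trans_le ?_
  refine (Finset.expect_le_expect fun ω _ => h1 ω).trans ?_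
  rw [Finset.expect_add_distrib, ← Finset.mul_expect, ← Finset.mul_expect, expect_setting,
    expect_setting]
  have hA : 𝔼 s, 𝔼 t, (signNormSq s ^ 2 *
      ∑ j, (signProb H M (s, t) j - signProb H N (s, t) j) ^ 2) ^ 2 ≤
      6561 * ((𝔼 s, 𝔼 t, (signForm (M - N) s t).re ^ 2) / (36 * K)) ^ 2 := by
    refine (Finset.expect_le_expect fun s _ => Finset.expect_le_expect fun t _ => hX s t).trans ?_
    have h2 : ∀ s, 𝔼 t, ∑ j, (signForm (M - N) s (H j * t)).re ^ 4 =
        K * 𝔼 t, (signForm (M - N) s t).re ^ 4 :=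
      fun s => expect_sum_rows H fun t => (signForm (M - N) s t).re ^ 4
    simp_rw [← Finset.mul_expect, h2, ← Finset.mul_expect]
    calc _ ≤ K / (6 * K) ^ 4 * (K * (6561 * (𝔼 s, 𝔼 t, (signForm (M - N) s t).re ^ 2) ^ 2)) := by
          gcongr
          exact expect_re_signForm_pow_four_le (M - N)
      _ = _ := by field_simp; ring
  have hB : 𝔼 s, 𝔼 t, signNormSq s ^ 4 * ∑ j, signProb H M (s, t) j ^ 2 ≤
      30000 * (din : ℝ) ^ 4 / K := by
    simp_rw [hP, ← Finset.mul_expect]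
    have h2 : ∀ s, 𝔼 t, ∑ j, ‖signForm M s (H j * t)‖ ^ 2 = K * 𝔼 t, ‖signForm M s t‖ ^ 2 :=
      fun s => expect_sum_rows H fun t => ‖signForm M s t‖ ^ 2
    simp_rw [h2]
    refine Finset.expect_le Finset.univ_nonempty fun s _ => ?_
    have hr0 := (signNormSq_pos hd s).le
    calc _ ≤ signNormSq s ^ 2 / (6 * K) ^ 2 * (K * (108 * signNormSq s ^ 2)) := by
          gcongr
          exact hM.expect_signForm_sq_le s
      _ = 3 * signNormSq s ^ 4 / K := by field_simp; ring
      _ ≤ 3 * (10 * din) ^ 4 / K := by gcongr; exact signNormSq_le s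
      _ = _ := by ring
  calc _ ≤ 2 * (6561 * ((𝔼 s, 𝔼 t, (signForm (M - N) s t).re ^ 2) / (36 * K)) ^ 2) +
        3 / m ^ 2 * (30000 * (din : ℝ) ^ 4 / K) := by gcongr
    _ = _ := by field_simp; ring

end measurement

/-! ### The tester -/

/-- The randomized tester that runs a uniformly random member of a finite family. -/
noncomputable def uniformTester {din dout n : ℕ} (Ω : Type) [Fintype Ω] [Nonempty Ω]
    (T : Ω → DetTester din dout n) : RandTester din dout n where
  Ω := Ω
  measurableSpace := ⊤
  μ := @PMF.toMeasure Ω ⊤ (PMF.uniformOfFintype Ω)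
  isProbabilityMeasure := @PMF.toMeasure.isProbabilityMeasure Ω ⊤ _
  tester := T
  measurable_outputProb := fun _ _ _ => measurable_from_top

theorem outputProb_uniformTester {din dout n : ℕ} (Ω : Type) [Fintype Ω] [Nonempty Ω]
    (T : Ω → DetTester din dout n) (M : Superop din dout) (b : Bool) :
    (uniformTester Ω T).outputProb M b = (Fintype.card Ω : ℝ)⁻¹ * ∑ ω, (T ω).outputProb M b := by
  let _ : MeasurableSpace Ω := ⊤
  change ∫ ω, (T ω).outputProb M b ∂(PMF.uniformOfFintype Ω).toMeasure = _
  rw [PMF.integral_eq_sum, Finset.mul_sum]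
  simp

section tester

variable {din dout K m S : ℕ}

/-- Queries are indexed by a block and a position in one of the two batches of the block. -/
noncomputable def queryEquiv (S m : ℕ) :
    Fin (Fintype.card (Fin S × (Fin m ⊕ Fin m))) ≃ Fin S × (Fin m ⊕ Fin m) :=
  (Fintype.equivFin _).symm

/-- The tester for the settings `ω` of `S` blocks, each with two batches of `m` queries: it accepts when
the collision statistics sum to less than `θ`. -/
noncomputable def signTester (hd : 0 < din) (hK : 0 < K) {H : Fin K → Fin dout × Fin 3 → ℤˣ}
    (hH : ∀ a b, ∑ j, ((H j a : ℤ) : ℝ) * ((H j b : ℤ) : ℝ) = if a = b then (K : ℝ) else 0)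
    (N : Superop din dout) (θ : ℝ) (m S : ℕ) (ω : Fin S → SignSetting din dout) :
    DetTester din dout (Fintype.card (Fin S × (Fin m ⊕ Fin m))) where
  ket j := signKet (ω (queryEquiv S m j).1).1
  norm_ket _ := norm_signKet hd _
  m _ := K
  povm j := signPovm H (ω (queryEquiv S m j).1).2
  povm_posSemidef _ a := signPovm_posSemidef H _ a
  povm_sum _ := sum_signPovm hK hH _
  decision x := decide
    (∑ σ, blockStat H N (ω σ, fun i => x ((queryEquiv S m).symm (σ, i))) < θ)

/-- Regroups the settings and the outcomes of all queries block by block. -/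
noncomputable def blockEquiv (A : Type*) (S m K : ℕ) : (Fin S → A × (Fin m ⊕ Fin m → Fin K)) ≃
    (Fin S → A) × (Fin (Fintype.card (Fin S × (Fin m ⊕ Fin m))) → Fin K) where
  toFun y := (fun σ => (y σ).1, fun j => (y (queryEquiv S m j).1).2 (queryEquiv S m j).2)
  invFun p := fun σ => (p.1 σ, fun i => p.2 ((queryEquiv S m).symm (σ, i)))
  left_inv y := by simp
  right_inv p := by simp

/-- The blocks are independent, settings included. -/
theorem outputProb_signTester (hd : 0 < din) (hK : 0 < K) {H : Fin K → Fin dout × Fin 3 → ℤˣ}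
    (hH : ∀ a b, ∑ j, ((H j a : ℤ) : ℝ) * ((H j b : ℤ) : ℝ) = if a = b then (K : ℝ) else 0)
    (N M : Superop din dout) (θ : ℝ) (m S : ℕ) (b : Bool) :
    (uniformTester _ (signTester hd hK hH N θ m S)).outputProb M b =
      ∑ y : Fin S → SignSetting din dout × (Fin m ⊕ Fin m → Fin K),
        if decide (∑ σ, blockStat H N (y σ) < θ) = b then ∏ σ, blockWeight H M (y σ) else 0 := by
  have hout : ∀ (ω : Fin S → SignSetting din dout)
      (x : Fin (Fintype.card (Fin S × (Fin m ⊕ Fin m))) → Fin K),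
      (signTester hd hK hH N θ m S ω).outcomeProb M x =
        ∏ j, signProb H M (ω (queryEquiv S m j).1) (x j) := fun ω x =>
    Finset.prod_congr rfl fun j _ => trace_signPovm_mul H hd M _ _
  rw [outputProb_uniformTester, Finset.mul_sum]
  simp only [DetTester.outputProb, Finset.mul_sum, mul_ite, mul_zero]
  rw [Fintype.sum_equiv (blockEquiv (SignSetting din dout) S m K) _ (fun p =>
    if decide (∑ σ, blockStat H N (p.1 σ, fun i => p.2 ((queryEquiv S m).symm (σ, i))) < θ) = b
    then (Fintype.card (Fin S → SignSetting din dout) : ℝ)⁻¹ *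
      ∏ j, signProb H M (p.1 (queryEquiv S m j).1) (p.2 j) else 0)]
  · rw [Fintype.sum_prod_type]
    simp only [← hout]
    rfl
  · intro y
    have h := (queryEquiv S m).prod_comp
      (fun k : Fin S × (Fin m ⊕ Fin m) => signProb H M (y k.1).1 ((y k.1).2 k.2))
    simp only [blockEquiv, Equiv.coe_fn_mk, Equiv.apply_symm_apply, Prod.mk.eta, h,
      Fintype.prod_prod_type, blockWeight, Finset.prod_mul_distrib,
      Finset.prod_const, Finset.card_univ, Fintype.card_fun, Fintype.card_fin, Nat.cast_pow, inv_pow]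

variable {M N : Superop din dout} {H : Fin K → Fin dout × Fin 3 → ℤˣ}

theorem blockWeight_nonneg (hM : IsChannel M)
    (y : SignSetting din dout × (Fin m ⊕ Fin m → Fin K)) : 0 ≤ blockWeight H M y :=
  mul_nonneg (by positivity) (Finset.prod_nonneg fun i _ => hM.signProb_nonneg H _ _)

theorem sum_blockWeight (hM : IsChannel M) (hd : 0 < din) (hK : 0 < K)
    (hH : ∀ a b, ∑ j, ((H j a : ℤ) : ℝ) * ((H j b : ℤ) : ℝ) = if a = b then (K : ℝ) else 0) :
    ∑ y : SignSetting din dout × (Fin m ⊕ Fin m → Fin K), blockWeight H M y = 1 := by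
  have h := sum_blockWeight_mul H M (m := m) (fun _ _ => 1)
  simp only [mul_one] at h
  rw [h]
  simp_rw [sum_prod_weight _ (hM.sum_signProb hd hK hH _)]
  exact Fintype.expect_const _

theorem expect_re_signForm_sub_sq (hM : IsChannel M) (hN : IsChannel N) :
    𝔼 s, 𝔼 t, (signForm (M - N) s t).re ^ 2 = 𝔼 s, 𝔼 t, ‖signForm (M - N) s t‖ ^ 2 := by
  refine Finset.expect_congr rfl fun s _ => Finset.expect_congr rfl fun t _ => ?_
  have h1 := Complex.nonneg_iff.mp (hM.signForm_nonneg s t)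
  have h2 := Complex.nonneg_iff.mp (hN.signForm_nonneg s t)
  rw [← Complex.normSq_eq_norm_sq, Complex.normSq_apply, signForm_sub, Complex.sub_im, ← h1.2,
    ← h2.2]
  ring

theorem acidNorm_sub_sq_le (hM : IsChannel M) (hN : IsChannel N) (hd : 0 < din) :
    acidNorm (M - N) ^ 2 ≤ dout / din * ((𝔼 s, 𝔼 t, (signForm (M - N) s t).re ^ 2) / 64) := by
  refine (acidNorm_sq_le hd _).trans ?_
  rw [expect_re_signForm_sub_sq hM hN]
  gcongr
  linarith [le_expect_signForm (M - N)]

/-- A bound for all pairs of channels; the factor `din * dout` is harmless where it is used. -/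
theorem acidNorm_sub_sq_le_const (hM : IsChannel M) (hN : IsChannel N) (hd : 0 < din) :
    acidNorm (M - N) ^ 2 ≤ 675 * din * dout := by
  have hd' : (din : ℝ) ≠ 0 := by positivity
  have hE : 𝔼 s, 𝔼 t, (signForm (M - N) s t).re ^ 2 ≤ 43200 * (din : ℝ) ^ 2 := by
    rw [expect_re_signForm_sub_sq hM hN]
    refine Finset.expect_le Finset.univ_nonempty fun s _ => ?_
    have h : ∀ t, ‖signForm (M - N) s t‖ ^ 2 ≤
        2 * ‖signForm M s t‖ ^ 2 + 2 * ‖signForm N s t‖ ^ 2 := fun t => by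
      rw [signForm_sub]
      have := parallelogram_law_with_norm ℝ (signForm M s t) (signForm N s t)
      nlinarith [mul_self_nonneg ‖signForm M s t + signForm N s t‖]
    refine (Finset.expect_le_expect fun t _ => h t).trans ?_
    rw [Finset.expect_add_distrib, ← Finset.mul_expect, ← Finset.mul_expect]
    have h1 := hM.expect_signForm_sq_le s
    have h2 := hN.expect_signForm_sq_le s
    have h3 : signNormSq s ^ 2 ≤ (10 * din) ^ 2 :=
      pow_le_pow_left₀ (signNormSq_pos hd s).le (signNormSq_le s) 2
    nlinarith
  refine (acidNorm_sub_sq_le hM hN hd).trans ?_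
  calc _ ≤ dout / din * (43200 * (din : ℝ) ^ 2 / 64) := by gcongr
    _ = _ := by field_simp; ring

/-- The threshold is half of the smallest mean `160000 τ` that a far channel can produce. The number
`160000` of blocks makes the Chebyshev error `4 * 13123 / 160000` at most `1 / 3`. -/
theorem signTester_decides (hN : IsChannel N) (hd : 0 < din) (hD : 0 < dout) (hK : 0 < K)
    (hKD : K ≤ 6 * dout)
    (hH : ∀ a b, ∑ j, ((H j a : ℤ) : ℝ) * ((H j b : ℤ) : ℝ) = if a = b then (K : ℝ) else 0)
    {ε : ℝ} (hε : 0 < ε) {m : ℕ}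
    (hm : 750 * ((din : ℝ) * (dout : ℝ) ^ (3 / 2 : ℝ) / ε ^ 2) ≤ m) :
    (uniformTester _ (signTester hd hK hH N (160000 * (ε ^ 2 * din / (K * dout)) / 2) m
      160000)).Decides N ε := by
  intro M hM
  set τ : ℝ := ε ^ 2 * din / (K * dout) with hτ
  have hdR : (0 : ℝ) < din := by positivity
  have hDR : (0 : ℝ) < dout := by positivity
  have hKR : (0 : ℝ) < K := by positivity
  have hτ0 : 0 < τ := by positivity
  have hmR : (0 : ℝ) < m := lt_of_lt_of_le (by positivity) hm
  have hm0 : m ≠ 0 := by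
    rintro rfl
    simp at hmR
  set μ := (𝔼 s, 𝔼 t, (signForm (M - N) s t).re ^ 2) / (36 * K) with hμ
  have hmean := sum_blockWeight_mul_blockStat (N := N) hM hd hK hm0 hH
  rw [← hμ] at hmean
  have hvar := sum_blockWeight_mul_blockStat_sq_le (N := N) hM hd hK hm0 hH
  rw [← hμ] at hvar
  have hnoise : 90000 * (din : ℝ) ^ 4 / (K * m ^ 2) ≤ τ ^ 2 := by
    have hD3 : ((dout : ℝ) ^ (3 / 2 : ℝ)) ^ 2 = (dout : ℝ) ^ 3 := by
      rw [← Real.rpow_natCast, ← Real.rpow_mul hDR.le, ← Real.rpow_natCast]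
      norm_num
    have hm2 : 562500 * ((din : ℝ) ^ 2 * (dout : ℝ) ^ 3 / ε ^ 4) ≤ (m : ℝ) ^ 2 := by
      calc _ = (750 * ((din : ℝ) * (dout : ℝ) ^ (3 / 2 : ℝ) / ε ^ 2)) ^ 2 := by
            rw [mul_pow, div_pow, mul_pow, hD3]; ring
        _ ≤ _ := pow_le_pow_left₀ (by positivity) hm 2
    have hKD' : (K : ℝ) ≤ 6 * dout := by exact_mod_cast hKD
    rw [div_le_iff₀ (by positivity), hτ]
    calc 90000 * (din : ℝ) ^ 4 ≤ 93750 * (din : ℝ) ^ 4 := by gcongr; norm_num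
      _ = (ε ^ 2 * din / dout) ^ 2 / (6 * dout) *
          (562500 * ((din : ℝ) ^ 2 * (dout : ℝ) ^ 3 / ε ^ 4)) := by field_simp; norm_num
      _ ≤ (ε ^ 2 * din / dout) ^ 2 / K * m ^ 2 := by gcongr
      _ = _ := by field_simp
  -- Both cases, with `ν = τ` for `M = N`, where `μ = 0`, and `ν = μ ≥ τ` for a far channel.
  have hcheb : ∀ ν : ℝ, 0 < ν → μ ^ 2 ≤ ν ^ 2 → τ ^ 2 ≤ ν ^ 2 → ∀ b : Bool,
      (∀ y : Fin 160000 → SignSetting din dout × (Fin m ⊕ Fin m → Fin K),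
        |∑ σ, blockStat H N (y σ) - 160000 * μ| < 160000 * ν / 2 →
          decide (∑ σ, blockStat H N (y σ) < 160000 * τ / 2) = b) →
      2 / 3 ≤ (uniformTester _ (signTester hd hK hH N (160000 * τ / 2) m 160000)).outputProb M b := by
    intro ν hν h1 h2 b hb
    rw [outputProb_signTester hd hK hH]
    refine le_trans ?_ (chebyshev_sum (ι := Fin 160000) (blockWeight H M)
      (blockWeight_nonneg hM) (sum_blockWeight hM hd hK hH) (blockStat H N)
      (δ := 160000 * ν / 2) (by positivity) _ (fun y hy => hb y ?_))
    · rw [Fintype.card_fin]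
      have : ∑ y, blockWeight H M y * blockStat (m := m) H N y ^ 2 ≤ 13123 * ν ^ 2 := by linarith
      have h3 : ((160000 : ℕ) : ℝ) * (∑ y, blockWeight H M y * blockStat (m := m) H N y ^ 2) /
          (160000 * ν / 2) ^ 2 ≤ ((160000 : ℕ) : ℝ) * (13123 * ν ^ 2) / (160000 * ν / 2) ^ 2 := by
        gcongr
      have h4 : ((160000 : ℕ) : ℝ) * (13123 * ν ^ 2) / (160000 * ν / 2) ^ 2 ≤ 1 / 3 := by
        rw [div_le_div_iff₀ (by positivity) (by positivity)]
        push_cast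
        nlinarith [sq_nonneg ν]
      linarith
    · rw [hmean, Fintype.card_fin] at hy
      exact_mod_cast hy
  constructor
  · rintro rfl
    have hμ0 : μ = 0 := by
      rw [hμ]
      simp [signForm]
    refine hcheb τ hτ0 (by rw [hμ0, zero_pow two_ne_zero]; positivity) le_rfl true fun y hy => ?_
    rw [hμ0, mul_zero, sub_zero] at hy
    exact decide_eq_true (lt_of_abs_lt hy)
  · intro hfar
    have hμτ : τ ≤ μ := by
      have h1 : ε ^ 2 ≤ acidNorm (M - N) ^ 2 := pow_le_pow_left₀ hε.le hfar 2
      have h2 := h1.trans (acidNorm_sub_sq_le hM hN hd)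
      have hE : 0 ≤ 𝔼 s, 𝔼 t, (signForm (M - N) s t).re ^ 2 :=
        Finset.expect_nonneg fun s _ => Finset.expect_nonneg fun t _ => sq_nonneg _
      rw [hτ, hμ]
      generalize 𝔼 s, 𝔼 t, (signForm (M - N) s t).re ^ 2 = E at h2 hE
      calc ε ^ 2 * din / (K * dout) ≤ dout / din * (E / 64) * din / (K * dout) := by gcongr
        _ = E / (64 * K) := by field_simp
        _ ≤ E / (36 * K) := by gcongr; norm_num
    refine hcheb μ (hτ0.trans_le hμτ) le_rfl (pow_le_pow_left₀ hτ0.le hμτ 2) false fun y hy => ?_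
    rw [decide_eq_false_iff_not, not_lt]
    have := (abs_lt.mp hy).1
    linarith

/-- The tester that accepts without any query. -/
def acceptTester (din dout : ℕ) : DetTester din dout 0 where
  ket j := j.elim0
  norm_ket j := j.elim0
  m j := j.elim0
  povm j := j.elim0
  povm_posSemidef j := j.elim0
  povm_sum j := j.elim0
  decision _ := true

/-- For so large an `ε` no channel is `ε`-far from `N`. -/
theorem acceptTester_decides (hN : IsChannel N) (hd : 0 < din) (hD : 0 < dout) {ε : ℝ}
    (hε : 0 < ε) (hF : (din : ℝ) * (dout : ℝ) ^ (3 / 2 : ℝ) / ε ^ 2 < 1 / 700) :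
    (uniformTester Unit fun _ => acceptTester din dout).Decides N ε := by
  intro M hM
  refine ⟨fun _ => ?_, fun hfar => ?_⟩
  · have h1 : (acceptTester din dout).outputProb M true = 1 := by
      simp [DetTester.outputProb, DetTester.outcomeProb, acceptTester]
      exact Fintype.card_unique
    rw [outputProb_uniformTester]
    simp [h1]
    norm_num
  · exfalso
    have h1 : ε ^ 2 ≤ acidNorm (M - N) ^ 2 := pow_le_pow_left₀ hε.le hfar 2
    have h2 := acidNorm_sub_sq_le_const hM hN hd
    have h3 : (dout : ℝ) ≤ (dout : ℝ) ^ (3 / 2 : ℝ) := by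
      conv_lhs => rw [← Real.rpow_one (dout : ℝ)]
      exact Real.rpow_le_rpow_of_exponent_le (by exact_mod_cast hD) (by norm_num)
    rw [div_lt_iff₀ (by positivity)] at hF
    have h4 : (din : ℝ) * dout ≤ din * (dout : ℝ) ^ (3 / 2 : ℝ) := by gcongr
    have h5 : (0 : ℝ) < din * dout := by positivity
    nlinarith

end tester

end ChannelTesting

theorem theorem1p7 :
    ∃ (C : ℝ) (k : ℕ), 0 < C ∧
      ∀ (din dout : ℕ), 0 < din → 0 < dout →
      ∀ (N : ChannelTesting.Superop din dout), ChannelTesting.IsChannel N →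
      ∀ ε : ℝ, 0 < ε →
        ∃ n : ℕ,
          (n : ℝ) ≤ C * ((din : ℝ) * (dout : ℝ) ^ (3 / 2 : ℝ) / ε ^ 2) *
            Real.logb 2 (2 + (din : ℝ) * (dout : ℝ) ^ (3 / 2 : ℝ) / ε ^ 2) ^ k ∧
          ∃ T : ChannelTesting.RandTester din dout n, T.Decides N ε := by
  -- There are `2 m * 160000` queries, with `m = ⌈750 F⌉ ≤ 1450 F` when `F ≥ 1 / 700`.
  refine ⟨320000 * 1450, 0, by norm_num, fun din dout hd hD N hN ε hε => ?_⟩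
  set F := (din : ℝ) * (dout : ℝ) ^ (3 / 2 : ℝ) / ε ^ 2 with hF
  have hF0 : 0 ≤ F := by positivity
  rw [pow_zero, mul_one]
  rcases lt_or_ge F (1 / 700) with hlt | hge
  · exact ⟨0, by rw [Nat.cast_zero]; positivity, _,
      ChannelTesting.acceptTester_decides hN hd hD hε hlt⟩
  · have : Nonempty (Fin dout × Fin 3) := ⟨(⟨0, hD⟩, 0)⟩
    obtain ⟨K, hK, hKle, H, hH⟩ := ChannelTesting.exists_orthogonal_signs (Fin dout × Fin 3)
    refine ⟨_, ?_, _, ChannelTesting.signTester_decides hN hd hD hK ?_ hH hε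
      (Nat.le_ceil (750 * F))⟩
    · have := Nat.ceil_lt_add_one (a := 750 * F) (by positivity)
      simp only [Fintype.card_prod, Fintype.card_sum, Fintype.card_fin]
      push_cast
      linarith
    · simp only [Fintype.card_prod, Fintype.card_fin] at hKle
      omega
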